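/- Let $n\ge 0$ be an integer, $\sigma>0$, let $z\sim N(0,\sigma^2 I_n)$, and let $\gamma=N(0,\sigma^2I_n)$ denote the law of $z$. Let $W^{1,2}(\gamma)$ be the completion of $C_0^\infty(\mathbb R^n)$ (smooth functions with compact support) for the norm $\|\varphi\|_{1,2}=\mathbb E[\varphi(z)^2]^{1/2}+\mathbb E[\|\nabla\varphi(z)\|^2]^{1/2}$. That is, $g\in W^{1,2}(\gamma)$ with weak gradient $\nabla g$ means that $g,\nabla g\in L^2(\gamma)$ and there are $\varphi_k\in C_0^\infty(\mathbb R^n)$ with $\varphi_k\to g$ and $\nabla\varphi_k\to\nabla g$ in $L^2(\gamma)$. (Equivalently, $x\mapsto g(\sigma x)$ lies in the Sobolev space $W^{1,2}(\gamma_n)$ of the standard Gaussian measure $\gamma_n=N(0,I_n)$.) Let $f=(f_1,\dots,f_n)^\top:\mathbb R^n\to\mathbb R^n$ have all components $f_i\in W^{1,2}(\gamma)$. Let $\nabla f$ be the $n\times n$ matrix with columns $\nabla f_1,\dots,\nabla f_n$, and let $\operatorname{div} f=\operatorname{tr}(\nabla f)=\sum_i \partial f_i/\partial x_i$. (a) For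 every $g\in W^{1,2}(\gamma)$, the random variable $z^\top f(z)-\sigma^2\operatorname{div} f(z)-g(z)$ is square integrable, and $$\operatorname{Var}\big(z^\top f(z)-\sigma^2\operatorname{div} f(z)-g(z)\big)=\mathbb E\big[\sigma^2\|f(z)-\nabla g(z)\|^2+\sigma^4\operatorname{tr}\big((\nabla f(z))^2\big)\big]+\tilde V(g)\le \mathbb E\big[\sigma^2\|f(z)-\nabla g(z)\|^2+\sigma^4\operatorname{tr}\big((\nabla f(z))^2\big)\big],$$ where $\tilde V(g)=\operatorname{Var}(g(z))-\sigma^2\,\mathbb E\|\nabla g(z)\|^2$; all these expectations and variances are finite. (b) Moreover, $$\operatorname{Var}[\operatorname{div} f(z)]=\mathbb E\big[\operatorname{tr}\big((\nabla f(z))^2\big)\big]+\operatorname{Var}\big[z^\top f(z)/\sigma^2\big]-\mathbb E\big[\|f(z)/\sigma\|^2\big]-2\,\mathbb E\big[f(z)^\top(\nabla f(z))z/\sigma^2\big],$$ where all terms are finite, and $$\operatorname{Var}[\operatorname{div} f(z)]\le \mathbb E\big[\operatorname{tr}\big((\nabla f(z))^2\big)\big]+\mathbb E\big[\|(\nabla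 f(z))z/\sigma\|^2\big],$$ where the last expectation is taken in $[0,\infty]$. No second derivatives of $f$ are required. -/

import Mathlib

open MeasureTheory ProbabilityTheory Filter Topology Matrix
open scoped ENNReal

/-- `φ : ℝⁿ → ℝ` is infinitely differentiable with compact support. -/
def IsTestFunction {n : ℕ} (φ : EuclideanSpace ℝ (Fin n) → ℝ) : Prop :=
  ContDiff ℝ (⊤ : ℕ∞) φ ∧ HasCompactSupport φ

/-- `HasSobolevGradient μ g G`: the function `g` belongs to the Sobolev space `W^{1,2}(μ)`, the
completion of the test functions for the norm `‖φ‖_{L²(μ)} + ‖∇φ‖_{L²(μ)}`, and `G` is (a version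
of) its weak gradient: `g` and `G` are square integrable and there are test functions `φ k` with
`φ k → g` and `∇(φ k) → G` in `L²(μ)`. -/
structure HasSobolevGradient {n : ℕ} (μ : Measure (EuclideanSpace ℝ (Fin n)))
    (g : EuclideanSpace ℝ (Fin n) → ℝ)
    (G : EuclideanSpace ℝ (Fin n) → EuclideanSpace ℝ (Fin n)) : Prop where
  memLp : MemLp g 2 μ
  memLp_gradient : MemLp G 2 μ
  exists_approx : ∃ φ : ℕ → EuclideanSpace ℝ (Fin n) → ℝ, (∀ k, IsTestFunction (φ k)) ∧
    Tendsto (fun k => eLpNorm (fun x => φ k x - g x) 2 μ +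
      eLpNorm (fun x => gradient (φ k) x - G x) 2 μ) atTop (𝓝 0)

/-- `HasSobolevJacobian μ f Df`: every component `f_i` of the vector field `f` belongs to
`W^{1,2}(μ)`, and `Df x` is the matrix with columns `∇f_1(x), …, ∇f_n(x)`, that is,
`Df x j i = ∂f_i/∂x_j (x)`. -/
def HasSobolevJacobian {n : ℕ} (μ : Measure (EuclideanSpace ℝ (Fin n)))
    (f : EuclideanSpace ℝ (Fin n) → EuclideanSpace ℝ (Fin n))
    (Df : EuclideanSpace ℝ (Fin n) → Matrix (Fin n) (Fin n) ℝ) : Prop :=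
  ∀ i : Fin n, HasSobolevGradient μ (fun x => f x i) (fun x => WithLp.toLp 2 ((Df x).col i))

/-- The product `A v` of a square matrix and a vector of Euclidean space. -/
noncomputable def matMulVec {n : ℕ} (A : Matrix (Fin n) (Fin n) ℝ)
    (v : EuclideanSpace ℝ (Fin n)) : EuclideanSpace ℝ (Fin n) :=
  WithLp.toLp 2 (A *ᵥ v.ofLp)

/-- The centred Gaussian distribution `N(0, σ² I)` on `ℝⁿ`. -/
noncomputable def isotropicGaussian (n : ℕ) (σ : ℝ) : Measure (EuclideanSpace ℝ (Fin n)) :=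
  multivariateGaussian 0 (σ ^ 2 • (1 : Matrix (Fin n) (Fin n) ℝ))

/-! ### Integration by parts and the Poincaré inequality for an isotropic Gaussian measure -/

section GaussianIntegration

variable {n : ℕ} {σ : ℝ}

/-! Write `δ_i φ = x_i φ - σ² ∂_i φ`. Gaussian integration by parts says that `δ_i` is the adjoint
of `σ² ∂_i` in `L²(γ)`. With the commutation rule `∂_i δ_j = δ_j ∂_i + 1_{i=j}` it gives `E[δ_i φ ·
δ_j ψ] = 1_{i=j} σ² E[φψ] + σ⁴ E[∂_j φ ∂_i ψ]`. Second derivatives occur only in the derivation, for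
test functions. The result involves first derivatives alone, so it extends to the Sobolev space by
`L²` limits. The extension needs `x_i φ_k` to converge too. The case `i = j` of the identity
supplies this, since it bounds `‖x_i φ‖` by the Sobolev norm of `φ`.

Put `d = x·f - σ² div f = ∑ δ_i f_i`. Then `E d = 0`, `E d² = σ² E‖f‖² + σ⁴ E tr((∇f)²)` and `E[d g]
= σ² E[f·∇g]`. Completing the square gives the formula in (a), and the bound there is the Poincaré
inequality for `g`. For (b), expand the variance of `σ² div f = x·f - d`, with `E[(x·f) d] = σ²
E‖f‖² + σ² E[f·(∇f)x]`. The bound is the Poincaré inequality for `x·f`, whose gradient is `f +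
(∇f)x`: its first two terms cancel the negative terms of the identity. As `x·f` is only locally
Sobolev a priori, a cutoff is used.

Integration by parts and the Poincaré inequality both come from invariance of `γ ⊗ γ` under the
rotations `(x, y) ↦ (cos t x + sin t y, -sin t x + cos t y)`, by differentiating in `t`. -/

instance isGaussian_isotropicGaussian : IsGaussian (isotropicGaussian n σ) := by
  unfold isotropicGaussian; infer_instance

lemma integral_id_isotropicGaussian : (isotropicGaussian n σ)[id] = 0 :=
  integral_id_multivariateGaussian'

lemma integral_inner_mul_inner_isotropicGaussian (a b : EuclideanSpace ℝ (Fin n)) :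
    ∫ x, inner ℝ a x * inner ℝ b x ∂(isotropicGaussian n σ) = σ ^ 2 * inner ℝ a b := by
  have h := covarianceBilin_apply
    (IsGaussian.memLp_two_id (μ := isotropicGaussian n σ)) a b
  rw [integral_id_isotropicGaussian] at h
  simp only [sub_zero] at h
  rw [← h]
  have hS : (σ ^ 2 • (1 : Matrix (Fin n) (Fin n) ℝ)).PosSemidef :=
    Matrix.PosSemidef.one.smul (sq_nonneg σ)
  unfold isotropicGaussian
  rw [covarianceBilin_multivariateGaussian hS]
  simp [Matrix.smul_mulVec, PiLp.inner_apply, dotProduct, mul_comm, mul_left_comm,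
    Finset.mul_sum]

/-- Second moments suffice for every integrand below: each grows at most quadratically, uniformly in
the rotation angle. -/
lemma integrable_prod_of_norm_le
    {g : EuclideanSpace ℝ (Fin n) × EuclideanSpace ℝ (Fin n) → ℝ} (hg : Continuous g) {C : ℝ}
    (h : ∀ p, |g p| ≤ C * (1 + ‖p.1‖ + ‖p.2‖) ^ 2) :
    Integrable g ((isotropicGaussian n σ).prod (isotropicGaussian n σ)) := by
  have h1 : MemLp (fun x : EuclideanSpace ℝ (Fin n) => ‖x‖) 2 (isotropicGaussian n σ) :=
    IsGaussian.memLp_two_id.norm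
  have h2 : MemLp (fun p : EuclideanSpace ℝ (Fin n) × EuclideanSpace ℝ (Fin n) => ‖p.1‖) 2
      ((isotropicGaussian n σ).prod (isotropicGaussian n σ)) := h1.comp_fst _
  have h3 : MemLp (fun p : EuclideanSpace ℝ (Fin n) × EuclideanSpace ℝ (Fin n) => ‖p.2‖) 2
      ((isotropicGaussian n σ).prod (isotropicGaussian n σ)) := h1.comp_snd _
  have h4 : MemLp (fun p : EuclideanSpace ℝ (Fin n) × EuclideanSpace ℝ (Fin n) =>
      1 + ‖p.1‖ + ‖p.2‖) 2 ((isotropicGaussian n σ).prod (isotropicGaussian n σ)) :=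
    ((memLp_const (1 : ℝ)).add h2).add h3
  exact (h4.integrable_sq.const_mul C).mono' hg.aestronglyMeasurable (ae_of_all _ h)

lemma integral_comp_rotation
    {g : EuclideanSpace ℝ (Fin n) × EuclideanSpace ℝ (Fin n) → ℝ} (hg : Continuous g) (θ : ℝ) :
    ∫ p, g (ContinuousLinearMap.rotation θ p)
        ∂((isotropicGaussian n σ).prod (isotropicGaussian n σ)) =
      ∫ p, g p ∂((isotropicGaussian n σ).prod (isotropicGaussian n σ)) := by
  conv_rhs => rw [← IsGaussian.map_rotation_eq_self
    (integral_id_isotropicGaussian (n := n) (σ := σ)) θ]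
  rw [integral_map (by fun_prop) hg.aestronglyMeasurable]

lemma norm_cos_smul_add_sin_smul_le (θ : ℝ) (x y : EuclideanSpace ℝ (Fin n)) :
    ‖Real.cos θ • x + Real.sin θ • y‖ ≤ ‖x‖ + ‖y‖ := by
  refine (norm_add_le _ _).trans (add_le_add ?_ ?_) <;> rw [norm_smul]
  · exact mul_le_of_le_one_left (norm_nonneg _) (Real.abs_cos_le_one θ)
  · exact mul_le_of_le_one_left (norm_nonneg _) (Real.abs_sin_le_one θ)

lemma norm_neg_sin_smul_add_cos_smul_le (θ : ℝ) (x y : EuclideanSpace ℝ (Fin n)) :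
    ‖-Real.sin θ • x + Real.cos θ • y‖ ≤ ‖x‖ + ‖y‖ := by
  refine (norm_add_le _ _).trans (add_le_add ?_ ?_) <;> rw [norm_smul]
  · exact mul_le_of_le_one_left (norm_nonneg _) (by simpa using Real.abs_sin_le_one θ)
  · exact mul_le_of_le_one_left (norm_nonneg _) (Real.abs_cos_le_one θ)

lemma hasDerivAt_cos_smul_add_sin_smul (θ : ℝ) (x y : EuclideanSpace ℝ (Fin n)) :
    HasDerivAt (fun t => Real.cos t • x + Real.sin t • y)
      (-Real.sin θ • x + Real.cos θ • y) θ :=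
  ((Real.hasDerivAt_cos θ).smul_const x).add ((Real.hasDerivAt_sin θ).smul_const y)

lemma hasDerivAt_neg_sin_smul_add_cos_smul (θ : ℝ) (x y : EuclideanSpace ℝ (Fin n)) :
    HasDerivAt (fun t => -Real.sin t • x + Real.cos t • y)
      (-(Real.cos θ • x + Real.sin θ • y)) θ := by
  refine (((Real.hasDerivAt_sin θ).neg.smul_const x).add
    ((Real.hasDerivAt_cos θ).smul_const y)).congr_deriv ?_
  module

/-- Gaussian integration by parts for functions that are bounded with a bounded derivative. -/
lemma integral_mul_inner_eq_integral_fderiv {φ : EuclideanSpace ℝ (Fin n) → ℝ}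
    (hφ : ContDiff ℝ 1 φ) {C : ℝ} (hC : ∀ x, |φ x| ≤ C) (hC' : ∀ x, ‖fderiv ℝ φ x‖ ≤ C)
    (a : EuclideanSpace ℝ (Fin n)) :
    ∫ x, φ x * inner ℝ a x ∂(isotropicGaussian n σ) =
      σ ^ 2 * ∫ x, fderiv ℝ φ x a ∂(isotropicGaussian n σ) := by
  set γ := isotropicGaussian n σ
  have hC0 : 0 ≤ C := (abs_nonneg _).trans (hC 0)
  have hφc : Continuous φ := hφ.continuous
  have hφ'c : Continuous (fderiv ℝ φ) := hφ.continuous_fderiv one_ne_zero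
  set X : ℝ → EuclideanSpace ℝ (Fin n) × EuclideanSpace ℝ (Fin n) → EuclideanSpace ℝ (Fin n) :=
    fun t p => Real.cos t • p.1 + Real.sin t • p.2
  set Y : ℝ → EuclideanSpace ℝ (Fin n) × EuclideanSpace ℝ (Fin n) → EuclideanSpace ℝ (Fin n) :=
    fun t p => -Real.sin t • p.1 + Real.cos t • p.2
  have hXc : ∀ t, Continuous (X t) := fun t => by fun_prop
  have hYc : ∀ t, Continuous (Y t) := fun t => by fun_prop
  set H : ℝ → EuclideanSpace ℝ (Fin n) × EuclideanSpace ℝ (Fin n) → ℝ :=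
    fun t p => φ (X t p) * inner ℝ a (Y t p)
  set H' : ℝ → EuclideanSpace ℝ (Fin n) × EuclideanSpace ℝ (Fin n) → ℝ :=
    fun t p => fderiv ℝ φ (X t p) (Y t p) * inner ℝ a (Y t p) + φ (X t p) * inner ℝ a (-(X t p))
  -- `(X t p, Y t p)` is the rotation of `p` by `t`, so the integral of `H t` does not depend on
  -- `t`. Integration by parts is the vanishing of its derivative at `t = 0`.
  have hconst : ∀ t, ∫ p, H t p ∂(γ.prod γ) = ∫ p, φ p.1 * inner ℝ a p.2 ∂(γ.prod γ) := fun t =>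
    integral_comp_rotation (g := fun p => φ p.1 * inner ℝ a p.2) (by fun_prop) t
  have hbd1 : ∀ t p, |fderiv ℝ φ (X t p) (Y t p) * inner ℝ a (Y t p)| ≤
      C * ‖a‖ * (‖p.1‖ + ‖p.2‖) ^ 2 := fun t p => by
    have hY : ‖Y t p‖ ≤ ‖p.1‖ + ‖p.2‖ := norm_neg_sin_smul_add_cos_smul_le t _ _
    rw [abs_mul]
    calc _ ≤ (C * (‖p.1‖ + ‖p.2‖)) * (‖a‖ * (‖p.1‖ + ‖p.2‖)) := by
          gcongr
          · exact ((fderiv ℝ φ (X t p)).le_opNorm _).trans (by gcongr; exact hC' _)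
          · exact (abs_real_inner_le_norm _ _).trans (by gcongr)
      _ = _ := by ring
  have hbd2 : ∀ t p, |φ (X t p) * inner ℝ a (-(X t p))| ≤ C * ‖a‖ * (‖p.1‖ + ‖p.2‖) :=
    fun t p => by
    have hX : ‖X t p‖ ≤ ‖p.1‖ + ‖p.2‖ := norm_cos_smul_add_sin_smul_le t _ _
    rw [abs_mul]
    calc _ ≤ C * (‖a‖ * (‖p.1‖ + ‖p.2‖)) := by
          gcongr
          · exact hC _
          · exact (abs_real_inner_le_norm _ _).trans (by rw [norm_neg]; gcongr)
      _ = _ := by ring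
  have hbd1' : ∀ t p, |fderiv ℝ φ (X t p) (Y t p) * inner ℝ a (Y t p)| ≤
      C * ‖a‖ * (1 + ‖p.1‖ + ‖p.2‖) ^ 2 := fun t p => (hbd1 t p).trans (by
    gcongr; linarith)
  have hbd2' : ∀ t p, |φ (X t p) * inner ℝ a (-(X t p))| ≤
      C * ‖a‖ * (1 + ‖p.1‖ + ‖p.2‖) ^ 2 := fun t p => (hbd2 t p).trans (by
    gcongr; nlinarith [norm_nonneg p.1, norm_nonneg p.2])
  have hbd3 : ∀ p : EuclideanSpace ℝ (Fin n) × EuclideanSpace ℝ (Fin n), |φ p.1 * inner ℝ a p.2| ≤ C * ‖a‖ * (1 + ‖p.1‖ + ‖p.2‖) ^ 2 := fun p => by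
    rw [abs_mul]
    calc _ ≤ C * (‖a‖ * (1 + ‖p.1‖ + ‖p.2‖) ^ 2) := by
          gcongr
          · exact hC _
          · refine (abs_real_inner_le_norm _ _).trans ?_
            gcongr; nlinarith [norm_nonneg p.1, norm_nonneg p.2]
      _ = _ := by ring
  have hi1 : Integrable (fun p => fderiv ℝ φ (X 0 p) (Y 0 p) * inner ℝ a (Y 0 p)) (γ.prod γ) :=
    integrable_prod_of_norm_le (by fun_prop) (hbd1' 0)
  have hi2 : Integrable (fun p => φ (X 0 p) * inner ℝ a (-(X 0 p))) (γ.prod γ) :=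
    integrable_prod_of_norm_le (by fun_prop) (hbd2' 0)
  have hW : Integrable (fun p : EuclideanSpace ℝ (Fin n) × EuclideanSpace ℝ (Fin n) =>
      (C * ‖a‖ + C * ‖a‖) * (1 + ‖p.1‖ + ‖p.2‖) ^ 2) (γ.prod γ) := by
    apply integrable_prod_of_norm_le (by fun_prop) (C := C * ‖a‖ + C * ‖a‖)
    intro p
    rw [abs_of_nonneg (by positivity)]
  have hder := (hasDerivAt_integral_of_dominated_loc_of_deriv_le (μ := γ.prod γ) (F := H)
    (F' := H') (x₀ := 0) Filter.univ_mem
    (Eventually.of_forall fun t => (by fun_prop : Continuous (H t)).aestronglyMeasurable)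
    (integrable_prod_of_norm_le (C := C * ‖a‖) (by fun_prop) (by simpa [H, X, Y] using hbd3))
    (by fun_prop : Continuous (H' 0)).aestronglyMeasurable
    (ae_of_all _ fun p t _ => by
      refine (abs_add_le _ _).trans ((add_le_add (hbd1' t p) (hbd2' t p)).trans_eq ?_)
      ring) hW
    (ae_of_all _ fun p t _ => by
      have h1 : HasDerivAt (fun t => φ (X t p)) (fderiv ℝ φ (X t p) (Y t p)) t :=
        ((hφ.differentiable one_ne_zero _).hasFDerivAt).comp_hasDerivAt t
          (hasDerivAt_cos_smul_add_sin_smul t p.1 p.2)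
      have h2 : HasDerivAt (fun t => inner ℝ a (Y t p)) (inner ℝ a (-(X t p))) t := by
        exact ((innerSL ℝ a).hasFDerivAt).comp_hasDerivAt t
          (hasDerivAt_neg_sin_smul_add_cos_smul t p.1 p.2)
      exact h1.mul h2)).2
  have hzero : ∫ p, H' 0 p ∂(γ.prod γ) = 0 := by
    have h1 : (fun t => ∫ p, H t p ∂(γ.prod γ)) =
        fun _ => ∫ p, φ p.1 * inner ℝ a p.2 ∂(γ.prod γ) := funext hconst
    rw [h1] at hder
    exact hder.unique (hasDerivAt_const _ _)
  rw [show H' 0 = fun p => fderiv ℝ φ (X 0 p) (Y 0 p) * inner ℝ a (Y 0 p) +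
    φ (X 0 p) * inner ℝ a (-(X 0 p)) from rfl, integral_add hi1 hi2, integral_prod _ hi1,
    integral_prod _ hi2] at hzero
  have hX0 : ∀ p, X 0 p = p.1 := fun p => by simp [X]
  have hY0 : ∀ p, Y 0 p = p.2 := fun p => by simp [Y]
  simp only [hX0, hY0, inner_neg_right, mul_neg, integral_neg, integral_const] at hzero
  -- Conditionally on the first variable, the second one enters through a product of two linear
  -- forms, evaluated by the covariance `σ² I`.
  have hcov : ∀ x, ∫ y, fderiv ℝ φ x y * inner ℝ a y ∂γ = σ ^ 2 * fderiv ℝ φ x a := fun x => by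
    simp_rw [← inner_gradient_left (f := φ) (x := x)]
    exact integral_inner_mul_inner_isotropicGaussian _ _
  simp only [hcov, integral_const_mul, probReal_univ, one_smul] at hzero
  linarith

/-- The **Gaussian Poincaré inequality** for bounded functions with a bounded derivative. -/
lemma variance_le_integral_norm_fderiv_sq {F : EuclideanSpace ℝ (Fin n) → ℝ}
    (hF : ContDiff ℝ 1 F) {C : ℝ} (hC : ∀ x, |F x| ≤ C) (hC' : ∀ x, ‖fderiv ℝ F x‖ ≤ C) :
    ∫ x, F x ^ 2 ∂(isotropicGaussian n σ) - (∫ x, F x ∂(isotropicGaussian n σ)) ^ 2 ≤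
      σ ^ 2 * ∫ x, ‖gradient F x‖ ^ 2 ∂(isotropicGaussian n σ) := by
  set γ := isotropicGaussian n σ
  have hC0 : 0 ≤ C := (abs_nonneg _).trans (hC 0)
  have hFc : Continuous F := hF.continuous
  have hF'c : Continuous (fderiv ℝ F) := hF.continuous_fderiv one_ne_zero
  have hG : gradient F = fun x => (InnerProductSpace.toDual ℝ _).symm (fderiv ℝ F x) := rfl
  have hGc : Continuous (gradient F) := by
    rw [hG]; fun_prop
  have hGn : ∀ x, ‖gradient F x‖ ≤ C := fun x => by
    rw [hG]; simpa using hC' x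
  set X : ℝ → EuclideanSpace ℝ (Fin n) × EuclideanSpace ℝ (Fin n) → EuclideanSpace ℝ (Fin n) :=
    fun t p => Real.cos t • p.1 + Real.sin t • p.2
  set Y : ℝ → EuclideanSpace ℝ (Fin n) × EuclideanSpace ℝ (Fin n) → EuclideanSpace ℝ (Fin n) :=
    fun t p => -Real.sin t • p.1 + Real.cos t • p.2
  have hXc : ∀ t, Continuous (X t) := fun t => by fun_prop
  have hYc : ∀ t, Continuous (Y t) := fun t => by fun_prop
  set D := ∫ x, ‖gradient F x‖ ^ 2 ∂γ
  -- `h` interpolates between `E[F²]` at `t = 0` and `(E F)²` at `t = π / 2`.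
  set h : ℝ → ℝ := fun t => ∫ p, F p.1 * F (X t p) ∂(γ.prod γ)
  have hone : ∀ p : EuclideanSpace ℝ (Fin n) × EuclideanSpace ℝ (Fin n),
      1 ≤ (1 + ‖p.1‖ + ‖p.2‖) ^ 2 := fun p => by
    nlinarith [norm_nonneg p.1, norm_nonneg p.2]
  have hsum : ∀ p : EuclideanSpace ℝ (Fin n) × EuclideanSpace ℝ (Fin n),
      ‖p.1‖ + ‖p.2‖ ≤ (1 + ‖p.1‖ + ‖p.2‖) ^ 2 := fun p => by
    nlinarith [norm_nonneg p.1, norm_nonneg p.2]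
  have hder : ∀ t, HasDerivAt h (∫ p, F p.1 * fderiv ℝ F (X t p) (Y t p) ∂(γ.prod γ)) t := by
    intro t
    refine (hasDerivAt_integral_of_dominated_loc_of_deriv_le (μ := γ.prod γ)
      (F := fun t p => F p.1 * F (X t p))
      (F' := fun t p => F p.1 * fderiv ℝ F (X t p) (Y t p)) (x₀ := t) Filter.univ_mem
      (bound := fun p => C * C * (1 + ‖p.1‖ + ‖p.2‖) ^ 2)
      (Eventually.of_forall fun t =>
        (by fun_prop : Continuous fun p => F p.1 * F (X t p)).aestronglyMeasurable)
      (integrable_prod_of_norm_le (C := C * C) (by fun_prop) fun p => ?_)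
      (by fun_prop : Continuous fun p => F p.1 * fderiv ℝ F (X t p) (Y t p)).aestronglyMeasurable
      (ae_of_all _ fun p t _ => ?_)
      (integrable_prod_of_norm_le (by fun_prop) (C := C * C) fun p => ?_)
      (ae_of_all _ fun p t _ => ?_)).2
    · rw [abs_mul]
      refine (mul_le_mul (hC _) (hC _) (abs_nonneg _) hC0).trans ?_
      exact le_mul_of_one_le_right (by positivity) (hone p)
    · rw [Real.norm_eq_abs, abs_mul, mul_assoc]
      refine mul_le_mul (hC _) ?_ (abs_nonneg _) hC0
      refine ((fderiv ℝ F (X t p)).le_opNorm _).trans ?_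
      refine mul_le_mul (hC' _) ?_ (norm_nonneg _) hC0
      exact (norm_neg_sin_smul_add_cos_smul_le t _ _).trans (hsum p)
    · rw [abs_of_nonneg (by positivity)]
    · exact (((hF.differentiable one_ne_zero _).hasFDerivAt).comp_hasDerivAt t
          (hasDerivAt_cos_smul_add_sin_smul t p.1 p.2)).const_mul _
  -- Rotating the variables turns the integrand into `F (X (-t) (u, v))` times a linear form in `v`.
  -- Integration by parts in `v` then yields the factor `-sin t`, the coefficient of `v` in `X (-t)
  -- (u, v)`.
  have hder' : ∀ t, ∫ p, F p.1 * fderiv ℝ F (X t p) (Y t p) ∂(γ.prod γ) =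
      -Real.sin t * σ ^ 2 *
        ∫ p, inner ℝ (gradient F (X (-t) p)) (gradient F p.1) ∂(γ.prod γ) := by
    intro t
    have h1 := integral_comp_rotation (σ := σ)
      (g := fun q => F (X (-t) q) * fderiv ℝ F q.1 q.2) (by fun_prop) t
    have h2 : ∀ p, X (-t) (ContinuousLinearMap.rotation t p) = p.1 := fun p => by
      have h3 := Real.cos_sq_add_sin_sq t
      simp only [X, ContinuousLinearMap.rotation_apply, Real.cos_neg, Real.sin_neg]
      calc Real.cos t • (Real.cos t • p.1 + Real.sin t • p.2) +
            -Real.sin t • (-Real.sin t • p.1 + Real.cos t • p.2) =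
          (Real.cos t ^ 2 + Real.sin t ^ 2) • p.1 := by module
        _ = p.1 := by rw [h3, one_smul]
    simp only [h2] at h1
    rw [show (fun p => F p.1 * fderiv ℝ F (X t p) (Y t p)) = fun p => F p.1 *
      fderiv ℝ F (ContinuousLinearMap.rotation t p).1 (ContinuousLinearMap.rotation t p).2
      from rfl, h1]
    rw [integral_prod, integral_prod, ← integral_const_mul]
    rotate_left
    · refine integrable_prod_of_norm_le (C := C * C) (by fun_prop) fun p => ?_
      refine (abs_real_inner_le_norm _ _).trans
        ((mul_le_mul (hGn _) (hGn _) (norm_nonneg _) hC0).trans ?_)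
      exact le_mul_of_one_le_right (by positivity) (hone p)
    · refine integrable_prod_of_norm_le (C := C * C) (by fun_prop) fun p => ?_
      rw [abs_mul, mul_assoc]
      refine mul_le_mul (hC _) ?_ (abs_nonneg _) hC0
      refine ((fderiv ℝ F _).le_opNorm _).trans ?_
      refine mul_le_mul (hC' _) ?_ (norm_nonneg _) hC0
      exact (le_add_of_nonneg_left (norm_nonneg _)).trans (hsum p)
    congr 1
    ext u
    have hd : ∀ v, HasFDerivAt (fun v => F (X (-t) (u, v)))
        (-Real.sin t • fderiv ℝ F (X (-t) (u, v))) v := fun v => by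
      have h4 : HasFDerivAt (fun v => X (-t) (u, v))
          (-Real.sin t • ContinuousLinearMap.id ℝ (EuclideanSpace ℝ (Fin n))) v := by
        simp only [X, Real.sin_neg]
        exact ((hasFDerivAt_id (𝕜 := ℝ) v).const_smul (-Real.sin t)).const_add (Real.cos (-t) • u)
      refine (((hF.differentiable one_ne_zero _).hasFDerivAt).comp v h4).congr_fderiv ?_
      ext; simp
    have hibp := integral_mul_inner_eq_integral_fderiv (σ := σ) (C := C)
      (φ := fun v => F (X (-t) (u, v))) (by fun_prop) (fun v => hC _) (fun v => by
        rw [(hd v).fderiv, norm_smul, norm_neg]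
        exact (mul_le_of_le_one_left (norm_nonneg _) (Real.abs_sin_le_one t)).trans (hC' _))
      (gradient F u)
    simp only [inner_gradient_left] at hibp ⊢
    rw [hibp]
    simp only [(hd _).fderiv, _root_.smul_apply, smul_eq_mul, integral_const_mul]
    ring
  have hGX : ∀ t, ∫ p, ‖gradient F (X t p)‖ ^ 2 ∂(γ.prod γ) = D := fun t => by
    have h1 := integral_comp_rotation (σ := σ) (g := fun q => ‖gradient F q.1‖ ^ 2)
      (by fun_prop) t
    have h2 : ∫ p, ‖gradient F p.1‖ ^ 2 ∂(γ.prod γ) = D := by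
      have := integral_fun_fst (μ := γ) (ν := γ) (fun x => ‖gradient F x‖ ^ 2)
      simpa using this
    exact h1.trans h2
  have hGi : ∀ t, Integrable (fun p => ‖gradient F (X t p)‖ ^ 2) (γ.prod γ) := fun t => by
    refine integrable_prod_of_norm_le (C := C ^ 2) (by fun_prop) fun p => ?_
    rw [abs_of_nonneg (by positivity)]
    exact (pow_le_pow_left₀ (norm_nonneg _) (hGn _) 2).trans
      (le_mul_of_one_le_right (by positivity) (hone p))
  have hX0 : ∀ p, X 0 p = p.1 := fun p => by simp [X]
  -- The inner product is at most half the sum of the squared norms, and both squares integrate to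
  -- `D` by rotation invariance.
  have hle : ∀ t, ∫ p, inner ℝ (gradient F (X (-t) p)) (gradient F p.1) ∂(γ.prod γ) ≤ D := by
    intro t
    have hD : D = ∫ p, (‖gradient F (X (-t) p)‖ ^ 2 / 2 + ‖gradient F (X 0 p)‖ ^ 2 / 2)
        ∂(γ.prod γ) := by
      rw [integral_add ((hGi _).div_const 2) ((hGi _).div_const 2), integral_div, integral_div,
        hGX, hGX]
      ring
    rw [hD]
    refine integral_mono ?_ (((hGi _).div_const 2).add ((hGi _).div_const 2)) fun p => ?_
    · refine integrable_prod_of_norm_le (C := C * C) (by fun_prop) fun p => ?_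
      refine (abs_real_inner_le_norm _ _).trans
        ((mul_le_mul (hGn _) (hGn _) (norm_nonneg _) hC0).trans ?_)
      exact le_mul_of_one_le_right (by positivity) (hone p)
    · have h1 := real_inner_le_norm (gradient F (X (-t) p)) (gradient F p.1)
      have h2 := sq_nonneg (‖gradient F (X (-t) p)‖ - ‖gradient F p.1‖)
      simp only [hX0]
      linarith
  -- Since `h' ≥ -sin t · σ² D` on `[0, π/2]`, subtracting `cos t · σ² D` leaves a nondecreasing
  -- function. Comparing the endpoints is the claim.
  have hmono : MonotoneOn (fun t => h t - Real.cos t * (σ ^ 2 * D)) (Set.Icc 0 (Real.pi / 2)) := by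
    have hd : ∀ t, HasDerivAt (fun t => h t - Real.cos t * (σ ^ 2 * D))
        (Real.sin t * σ ^ 2 *
          (D - ∫ p, inner ℝ (gradient F (X (-t) p)) (gradient F p.1) ∂(γ.prod γ))) t := fun t => by
      refine ((hder t).sub ((Real.hasDerivAt_cos t).mul_const (σ ^ 2 * D))).congr_deriv ?_
      rw [hder' t]
      ring
    refine monotoneOn_of_deriv_nonneg (convex_Icc _ _)
      (fun t _ => (hd t).continuousAt.continuousWithinAt)
      (fun t _ => (hd t).differentiableAt.differentiableWithinAt) fun t ht => ?_
    rw [interior_Icc] at ht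
    rw [(hd t).deriv]
    have hs : 0 ≤ Real.sin t :=
      Real.sin_nonneg_of_nonneg_of_le_pi ht.1.le (by linarith [ht.2, Real.pi_pos])
    exact mul_nonneg (mul_nonneg hs (sq_nonneg σ)) (sub_nonneg.2 (hle t))
  have hfin := hmono (Set.left_mem_Icc.2 (by positivity)) (Set.right_mem_Icc.2 (by positivity))
    (by positivity : (0 : ℝ) ≤ Real.pi / 2)
  have h0 : h 0 = ∫ x, F x ^ 2 ∂γ := by
    have := integral_fun_fst (μ := γ) (ν := γ) (fun x => F x ^ 2)
    simp only [h, hX0, ← sq]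
    simpa using this
  have h1 : h (Real.pi / 2) = (∫ x, F x ∂γ) ^ 2 := by
    simp only [h, X, Real.cos_pi_div_two, Real.sin_pi_div_two, zero_smul, one_smul, zero_add]
    rw [integral_prod_mul, sq]
  simp only [h0, h1, Real.cos_zero, Real.cos_pi_div_two] at hfin
  linarith

end GaussianIntegration

/-! ### Test functions -/

section TestFunctions

variable {n : ℕ} {σ : ℝ} {φ ψ : EuclideanSpace ℝ (Fin n) → ℝ}

lemma gradient_apply_eq_fderiv (φ : EuclideanSpace ℝ (Fin n) → ℝ) (x : EuclideanSpace ℝ (Fin n))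
    (i : Fin n) : gradient φ x i = fderiv ℝ φ x (EuclideanSpace.single i 1) := by
  rw [← inner_gradient_left, EuclideanSpace.inner_single_right]
  simp

namespace IsTestFunction

lemma differentiable (hφ : IsTestFunction φ) : Differentiable ℝ φ :=
  hφ.1.differentiable (by simp)

lemma continuous (hφ : IsTestFunction φ) : Continuous φ := hφ.1.continuous

lemma zero : IsTestFunction (fun _ : EuclideanSpace ℝ (Fin n) => (0 : ℝ)) :=
  ⟨contDiff_const, HasCompactSupport.zero⟩

lemma add (hφ : IsTestFunction φ) (hψ : IsTestFunction ψ) :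
    IsTestFunction (fun x => φ x + ψ x) :=
  ⟨hφ.1.add hψ.1, hφ.2.add hψ.2⟩

lemma smooth_mul {η : EuclideanSpace ℝ (Fin n) → ℝ} (hη : ContDiff ℝ (⊤ : ℕ∞) η)
    (hφ : IsTestFunction φ) : IsTestFunction (fun x => η x * φ x) :=
  ⟨hη.mul hφ.1, hφ.2.mul_left⟩

lemma mul (hφ : IsTestFunction φ) (hψ : IsTestFunction ψ) :
    IsTestFunction (fun x => φ x * ψ x) := smooth_mul hφ.1 hψ

lemma const_mul (hφ : IsTestFunction φ) (c : ℝ) : IsTestFunction (fun x => c * φ x) :=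
  smooth_mul contDiff_const hφ

lemma sub (hφ : IsTestFunction φ) (hψ : IsTestFunction ψ) :
    IsTestFunction (fun x => φ x - ψ x) := by
  simpa [sub_eq_add_neg] using hφ.add (hψ.const_mul (-1))

lemma coord_mul (hφ : IsTestFunction φ) (i : Fin n) : IsTestFunction (fun x => x i * φ x) :=
  smooth_mul (EuclideanSpace.proj (𝕜 := ℝ) i).contDiff hφ

lemma gradient_apply (hφ : IsTestFunction φ) (i : Fin n) :
    IsTestFunction (fun x => gradient φ x i) := by
  simp_rw [gradient_apply_eq_fderiv]
  refine ⟨?_, ?_⟩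
  · exact (hφ.1.fderiv_right (m := (⊤ : ℕ∞)) (by simp)).clm_apply contDiff_const
  · exact hφ.2.fderiv_apply ℝ _

lemma continuous_gradient (hφ : IsTestFunction φ) : Continuous (gradient φ) :=
  (InnerProductSpace.toDual ℝ (EuclideanSpace ℝ (Fin n))).symm.continuous.comp
    (hφ.1.continuous_fderiv (by simp))

lemma norm_gradient_eq (φ : EuclideanSpace ℝ (Fin n) → ℝ) (x : EuclideanSpace ℝ (Fin n)) :
    ‖gradient φ x‖ = ‖fderiv ℝ φ x‖ :=
  (InnerProductSpace.toDual ℝ (EuclideanSpace ℝ (Fin n))).symm.norm_map _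

lemma hasCompactSupport_gradient (hφ : IsTestFunction φ) : HasCompactSupport (gradient φ) := by
  have h := hφ.2.fderiv ℝ
  exact h.comp_left (g := (InnerProductSpace.toDual ℝ (EuclideanSpace ℝ (Fin n))).symm)
    (map_zero _)

lemma exists_bound (hφ : IsTestFunction φ) :
    ∃ C, (∀ x, |φ x| ≤ C) ∧ ∀ x, ‖fderiv ℝ φ x‖ ≤ C := by
  obtain ⟨C, hC⟩ := hφ.2.exists_bound_of_continuous hφ.continuous
  obtain ⟨C', hC'⟩ := (hφ.2.fderiv ℝ).exists_bound_of_continuous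
    (hφ.1.continuous_fderiv (by simp))
  exact ⟨max C C', fun x => (hC x).trans (le_max_left _ _),
    fun x => (hC' x).trans (le_max_right _ _)⟩

lemma memLp {μ : Measure (EuclideanSpace ℝ (Fin n))} [IsFiniteMeasure μ] (hφ : IsTestFunction φ)
    (p : ℝ≥0∞) : MemLp φ p μ :=
  hφ.continuous.memLp_of_hasCompactSupport hφ.2

lemma memLp_gradient {μ : Measure (EuclideanSpace ℝ (Fin n))} [IsFiniteMeasure μ]
    (hφ : IsTestFunction φ) (p : ℝ≥0∞) : MemLp (gradient φ) p μ :=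
  hφ.continuous_gradient.memLp_of_hasCompactSupport hφ.hasCompactSupport_gradient

lemma integrable {μ : Measure (EuclideanSpace ℝ (Fin n))} [IsFiniteMeasure μ]
    (hφ : IsTestFunction φ) : Integrable φ μ :=
  memLp_one_iff_integrable.1 (hφ.memLp 1)

end IsTestFunction

lemma gradient_fun_mul {x : EuclideanSpace ℝ (Fin n)} (hφ : DifferentiableAt ℝ φ x)
    (hψ : DifferentiableAt ℝ ψ x) :
    gradient (fun x => φ x * ψ x) x = φ x • gradient ψ x + ψ x • gradient φ x := by
  ext i
  simp [gradient_apply_eq_fderiv, fderiv_fun_mul hφ hψ]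

lemma gradient_fun_add {x : EuclideanSpace ℝ (Fin n)} (hφ : DifferentiableAt ℝ φ x)
    (hψ : DifferentiableAt ℝ ψ x) :
    gradient (fun x => φ x + ψ x) x = gradient φ x + gradient ψ x := by
  ext i
  simp [gradient_apply_eq_fderiv, fderiv_fun_add hφ hψ]

lemma gradient_fun_sub {x : EuclideanSpace ℝ (Fin n)} (hφ : DifferentiableAt ℝ φ x)
    (hψ : DifferentiableAt ℝ ψ x) :
    gradient (fun x => φ x - ψ x) x = gradient φ x - gradient ψ x := by
  ext i
  simp [gradient_apply_eq_fderiv, fderiv_fun_sub hφ hψ]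

lemma gradient_const_mul_apply (c : ℝ) {x : EuclideanSpace ℝ (Fin n)}
    (hφ : DifferentiableAt ℝ φ x) (i : Fin n) :
    gradient (fun x => c * φ x) x i = c * gradient φ x i := by
  simp [gradient_apply_eq_fderiv, fderiv_const_mul hφ]

lemma gradient_coord_mul_apply {x : EuclideanSpace ℝ (Fin n)} (hφ : DifferentiableAt ℝ φ x)
    (i j : Fin n) :
    gradient (fun x => x i * φ x) x j = (if i = j then φ x else 0) + x i * gradient φ x j := by
  have h : HasFDerivAt (fun x : EuclideanSpace ℝ (Fin n) => x i)
      (EuclideanSpace.proj (𝕜 := ℝ) i) x := (EuclideanSpace.proj (𝕜 := ℝ) i).hasFDerivAt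
  rw [gradient_apply_eq_fderiv, gradient_apply_eq_fderiv, fderiv_fun_mul h.differentiableAt hφ,
    h.fderiv]
  simp [PiLp.single_apply, add_comm]

lemma gradient_gradient_comm (hφ : IsTestFunction φ) (x : EuclideanSpace ℝ (Fin n))
    (i j : Fin n) :
    gradient (fun x => gradient φ x j) x i = gradient (fun x => gradient φ x i) x j := by
  have hd : DifferentiableAt ℝ (fderiv ℝ φ) x :=
    (hφ.1.fderiv_right (m := (⊤ : ℕ∞)) (by simp)).differentiable (by simp) x
  have h : ∀ k l : Fin n, gradient (fun x => gradient φ x k) x l =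
      fderiv ℝ (fderiv ℝ φ) x (EuclideanSpace.single l 1) (EuclideanSpace.single k 1) := by
    intro k l
    simp_rw [gradient_apply_eq_fderiv]
    rw [fderiv_clm_apply hd (differentiableAt_const _)]
    simp
  rw [h, h]
  have hs : IsSymmSndFDerivAt ℝ φ x := hφ.1.contDiffAt.isSymmSndFDerivAt (by
    rw [minSmoothness_of_isRCLikeNormedField]
    exact WithTop.coe_le_coe.2 (le_top : (2 : ℕ∞) ≤ ⊤))
  exact hs _ _

variable (σ) in
lemma integral_coord_mul_test (hφ : IsTestFunction φ) (i : Fin n) :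
    ∫ x, x i * φ x ∂(isotropicGaussian n σ) =
      σ ^ 2 * ∫ x, gradient φ x i ∂(isotropicGaussian n σ) := by
  obtain ⟨C, hC, hC'⟩ := hφ.exists_bound
  have h := integral_mul_inner_eq_integral_fderiv (σ := σ) (hφ.1.of_le (by simp)) hC hC'
    (EuclideanSpace.single i 1)
  simpa [gradient_apply_eq_fderiv, EuclideanSpace.inner_single_left, mul_comm] using h

/-- The Gaussian divergence `φ ↦ x i * φ - σ ^ 2 * ∂ᵢ φ` of a test function along the `i`-th
coordinate is a test function. -/
lemma IsTestFunction.coord_mul_sub (hφ : IsTestFunction φ) (i : Fin n) :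
    IsTestFunction (fun x => x i * φ x - σ ^ 2 * gradient φ x i) :=
  (hφ.coord_mul i).sub ((hφ.gradient_apply i).const_mul _)

variable (σ) in
-- Adjointness of `δ_i` and `σ² ∂_i`: integration by parts applied to the product `φ ψ`.
lemma integral_coord_mul_sub_mul_test (hφ : IsTestFunction φ) (hψ : IsTestFunction ψ)
    (i : Fin n) :
    ∫ x, (x i * φ x - σ ^ 2 * gradient φ x i) * ψ x ∂(isotropicGaussian n σ) =
      σ ^ 2 * ∫ x, φ x * gradient ψ x i ∂(isotropicGaussian n σ) := by
  have h := integral_coord_mul_test σ (hφ.mul hψ) i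
  have h1 : ∀ x, gradient (fun x => φ x * ψ x) x i =
      φ x * gradient ψ x i + ψ x * gradient φ x i := fun x => by
    simp [gradient_fun_mul (hφ.differentiable x) (hψ.differentiable x)]
  simp only [h1] at h
  have i1 := ((hφ.mul hψ).coord_mul i).integrable (μ := isotropicGaussian n σ)
  have i2 := (hφ.mul (hψ.gradient_apply i)).integrable (μ := isotropicGaussian n σ)
  have i3 := (hψ.mul (hφ.gradient_apply i)).integrable (μ := isotropicGaussian n σ)
  rw [integral_add i2 i3] at h
  have h2 : ∀ x, (x i * φ x - σ ^ 2 * gradient φ x i) * ψ x =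
      x i * (φ x * ψ x) - σ ^ 2 * (ψ x * gradient φ x i) := fun x => by ring
  simp only [h2]
  rw [integral_sub i1 (i3.const_mul _), integral_const_mul, h]
  ring

variable (σ) in
-- Adjointness moves `δ_i` onto `δ_j ψ` as `∂_i`, the commutation rule exchanges the two operators,
-- and adjointness moves `δ_j` back onto `φ`.
lemma integral_coord_mul_sub_mul_coord_mul_sub_test (hφ : IsTestFunction φ)
    (hψ : IsTestFunction ψ) (i j : Fin n) :
    ∫ x, (x i * φ x - σ ^ 2 * gradient φ x i) * (x j * ψ x - σ ^ 2 * gradient ψ x j)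
        ∂(isotropicGaussian n σ) =
      (if i = j then σ ^ 2 * ∫ x, φ x * ψ x ∂(isotropicGaussian n σ) else 0) +
        σ ^ 4 * ∫ x, gradient φ x j * gradient ψ x i ∂(isotropicGaussian n σ) := by
  rw [integral_coord_mul_sub_mul_test σ hφ (hψ.coord_mul_sub j) i]
  -- The commutation rule `∂_i δ_j ψ = 1_{i=j} ψ + δ_j ∂_i ψ`, which rests on the symmetry of second
  -- derivatives.
  have h1 : ∀ x, φ x * gradient (fun x => x j * ψ x - σ ^ 2 * gradient ψ x j) x i =
      (if i = j then φ x * ψ x else 0) +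
        (x j * gradient ψ x i - σ ^ 2 * gradient (fun x => gradient ψ x i) x j) * φ x := by
    intro x
    rw [gradient_fun_sub ((hψ.coord_mul j).differentiable x)
      (((hψ.gradient_apply j).const_mul _).differentiable x), PiLp.sub_apply,
      gradient_coord_mul_apply (hψ.differentiable x),
      gradient_const_mul_apply _ ((hψ.gradient_apply j).differentiable x),
      gradient_gradient_comm hψ]
    by_cases h : i = j
    · simp only [h, if_true]; ring
    · simp only [h, Ne.symm h, if_false]; ring
  simp only [h1]
  have i1 : Integrable (fun x => if i = j then φ x * ψ x else 0) (isotropicGaussian n σ) := by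
    split_ifs
    · exact (hφ.mul hψ).integrable
    · exact integrable_zero _ _ _
  rw [integral_add i1 (((hψ.gradient_apply i).coord_mul_sub j).mul hφ).integrable,
    integral_coord_mul_sub_mul_test σ (hψ.gradient_apply i) hφ j]
  simp only [mul_comm (gradient ψ _ _)]
  split_ifs
  · ring
  · simp only [integral_zero]; ring

variable (σ) in
lemma integral_coord_mul_mul_coord_mul_sub_test (hφ : IsTestFunction φ)
    (hψ : IsTestFunction ψ) (i j : Fin n) :
    ∫ x, (x i * φ x) * (x j * ψ x - σ ^ 2 * gradient ψ x j) ∂(isotropicGaussian n σ) =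
      (if i = j then σ ^ 2 * ∫ x, φ x * ψ x ∂(isotropicGaussian n σ) else 0) +
        σ ^ 2 * ∫ x, (x i * ψ x) * gradient φ x j ∂(isotropicGaussian n σ) := by
  have h := integral_coord_mul_sub_mul_test σ hψ (hφ.coord_mul i) j
  have h1 : ∀ x, ψ x * gradient (fun x => x i * φ x) x j =
      (if i = j then φ x * ψ x else 0) + (x i * ψ x) * gradient φ x j := fun x => by
    rw [gradient_coord_mul_apply (hφ.differentiable x)]
    split_ifs <;> ring
  simp only [h1] at h
  have i1 : Integrable (fun x => if i = j then φ x * ψ x else 0) (isotropicGaussian n σ) := by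
    split_ifs
    · exact (hφ.mul hψ).integrable
    · exact integrable_zero _ _ _
  rw [integral_add i1 ((hψ.coord_mul i).mul (hφ.gradient_apply j)).integrable] at h
  simp only [mul_comm (_ * φ _)]
  rw [h]
  split_ifs
  · ring
  · simp only [integral_zero]; ring

end TestFunctions

/-! ### Convergence in `L²` -/

section TendstoL2

variable {α : Type*} [MeasurableSpace α] {μ : Measure α}

/-- The sequence of real functions `u k` converges to `v` in `L²(μ)`; all of them are square
integrable. -/
structure TendstoL2 (μ : Measure α) (u : ℕ → α → ℝ) (v : α → ℝ) : Prop where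
  memLp : ∀ k, MemLp (u k) 2 μ
  memLp_lim : MemLp v 2 μ
  tendsto : Tendsto (fun k => eLpNorm (fun x => u k x - v x) 2 μ) atTop (𝓝 0)

namespace TendstoL2

variable {u u' : ℕ → α → ℝ} {v v' : α → ℝ}

lemma const (hv : MemLp v 2 μ) : TendstoL2 μ (fun _ => v) v :=
  ⟨fun _ => hv, hv, by simp⟩

lemma const_mul (h : TendstoL2 μ u v) (c : ℝ) :
    TendstoL2 μ (fun k x => c * u k x) (fun x => c * v x) := by
  refine ⟨fun k => (h.memLp k).const_mul c, h.memLp_lim.const_mul c, ?_⟩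
  have h1 : ∀ k, eLpNorm (fun x => c * u k x - c * v x) 2 μ =
      ‖c‖ₑ * eLpNorm (fun x => u k x - v x) 2 μ := fun k => by
    rw [← eLpNorm_const_smul]
    congr 1
    ext x
    simp [mul_sub]
  simp only [h1]
  simpa using ENNReal.Tendsto.const_mul h.tendsto (Or.inr (enorm_ne_top (x := c)))

lemma add (h : TendstoL2 μ u v) (h' : TendstoL2 μ u' v') :
    TendstoL2 μ (fun k x => u k x + u' k x) (fun x => v x + v' x) := by
  refine ⟨fun k => (h.memLp k).add (h'.memLp k), h.memLp_lim.add h'.memLp_lim, ?_⟩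
  refine tendsto_of_tendsto_of_tendsto_of_le_of_le tendsto_const_nhds
    (by simpa using h.tendsto.add h'.tendsto) (fun k => zero_le) fun k => ?_
  refine le_trans (le_of_eq ?_) (eLpNorm_add_le ((h.memLp k).sub h.memLp_lim).1
    ((h'.memLp k).sub h'.memLp_lim).1 one_le_two)
  congr 1
  ext x
  simp only [Pi.add_apply]
  ring

lemma sub (h : TendstoL2 μ u v) (h' : TendstoL2 μ u' v') :
    TendstoL2 μ (fun k x => u k x - u' k x) (fun x => v x - v' x) := by
  simpa [sub_eq_add_neg] using h.add (h'.const_mul (-1))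

/-- Joint continuity of the inner product of `L²`; this is how every bilinear identity passes from
test functions to limits. -/
lemma tendsto_integral_mul (h : TendstoL2 μ u v) (h' : TendstoL2 μ u' v') :
    Tendsto (fun k => ∫ x, u k x * u' k x ∂μ) atTop (𝓝 (∫ x, v x * v' x ∂μ)) := by
  have key : ∀ {f g : α → ℝ} (hf : MemLp f 2 μ) (hg : MemLp g 2 μ),
      ∫ x, f x * g x ∂μ = inner ℝ (hf.toLp f) (hg.toLp g) := by
    intro f g hf hg
    rw [L2.inner_def]
    refine integral_congr_ae ?_
    filter_upwards [hf.coeFn_toLp, hg.coeFn_toLp] with x h1 h2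
    simp [h1, h2, mul_comm]
  rw [key h.memLp_lim h'.memLp_lim]
  simp only [key (h.memLp _) (h'.memLp _)]
  exact ((Lp.tendsto_Lp_iff_tendsto_eLpNorm'' _ h.memLp _ h.memLp_lim).2 h.tendsto).inner
    ((Lp.tendsto_Lp_iff_tendsto_eLpNorm'' _ h'.memLp _ h'.memLp_lim).2 h'.tendsto)

lemma tendsto_integral [IsFiniteMeasure μ] (h : TendstoL2 μ u v) :
    Tendsto (fun k => ∫ x, u k x ∂μ) atTop (𝓝 (∫ x, v x ∂μ)) := by
  simpa using h.tendsto_integral_mul (const (memLp_const (1 : ℝ)))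

end TendstoL2

lemma eLpNorm_two_eq_sqrt_integral_sq {u : α → ℝ} (hu : MemLp u 2 μ) :
    eLpNorm u 2 μ = ENNReal.ofReal √(∫ x, u x ^ 2 ∂μ) := by
  rw [hu.eLpNorm_eq_integral_rpow_norm two_ne_zero ENNReal.ofNat_ne_top, Real.sqrt_eq_rpow]
  norm_num

end TendstoL2

/-! ### Functions with a weak gradient in the Gaussian Sobolev space -/

section Sobolev

variable {n : ℕ} {σ : ℝ}

lemma MeasureTheory.MemLp.euclideanSpace_apply {μ : Measure (EuclideanSpace ℝ (Fin n))}
    {G : EuclideanSpace ℝ (Fin n) → EuclideanSpace ℝ (Fin n)} {p : ℝ≥0∞} (hG : MemLp G p μ)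
    (i : Fin n) : MemLp (fun x => G x i) p μ :=
  (EuclideanSpace.proj (𝕜 := ℝ) i).comp_memLp' hG

lemma eLpNorm_euclideanSpace_apply_le {μ : Measure (EuclideanSpace ℝ (Fin n))}
    (G : EuclideanSpace ℝ (Fin n) → EuclideanSpace ℝ (Fin n)) (p : ℝ≥0∞) (i : Fin n) :
    eLpNorm (fun x => G x i) p μ ≤ eLpNorm G p μ :=
  eLpNorm_mono fun x => PiLp.norm_apply_le (G x) i

variable (n σ) in
-- Multiplication by `x_i` costs one derivative: `x_i φ = δ_i φ + σ² ∂_i φ`, and `‖δ_i φ‖² = σ² ‖φ‖²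
-- + σ⁴ ‖∂_i φ‖²`. Hence the constant `|σ| + 2σ²`.
lemma exists_eLpNorm_coord_mul_test_le : ∃ C : ℝ≥0∞, C ≠ ∞ ∧
    ∀ φ : EuclideanSpace ℝ (Fin n) → ℝ, IsTestFunction φ → ∀ i,
      eLpNorm (fun x => x i * φ x) 2 (isotropicGaussian n σ) ≤
        C * (eLpNorm φ 2 (isotropicGaussian n σ) +
          eLpNorm (gradient φ) 2 (isotropicGaussian n σ)) := by
  refine ⟨ENNReal.ofReal |σ| + ENNReal.ofReal (σ ^ 2) + ENNReal.ofReal (σ ^ 2), by simp,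
    fun φ hφ i => ?_⟩
  set γ := isotropicGaussian n σ
  have hg := eLpNorm_euclideanSpace_apply_le (μ := γ) (gradient φ) 2 i
  have h1 : eLpNorm (fun x => σ ^ 2 * gradient φ x i) 2 γ =
      ENNReal.ofReal (σ ^ 2) * eLpNorm (fun x => gradient φ x i) 2 γ := by
    rw [← Real.enorm_of_nonneg (sq_nonneg σ), ← eLpNorm_const_smul]
    rfl
  have h2 : eLpNorm (fun x => x i * φ x - σ ^ 2 * gradient φ x i) 2 γ ≤
      ENNReal.ofReal |σ| * eLpNorm φ 2 γ +
        ENNReal.ofReal (σ ^ 2) * eLpNorm (fun x => gradient φ x i) 2 γ := by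
    rw [eLpNorm_two_eq_sqrt_integral_sq ((hφ.coord_mul_sub i).memLp 2),
      eLpNorm_two_eq_sqrt_integral_sq (hφ.memLp 2),
      eLpNorm_two_eq_sqrt_integral_sq ((hφ.gradient_apply i).memLp 2),
      ← ENNReal.ofReal_mul (abs_nonneg σ), ← ENNReal.ofReal_mul (sq_nonneg σ),
      ← ENNReal.ofReal_add (by positivity) (by positivity)]
    refine ENNReal.ofReal_le_ofReal ?_
    have h3 := integral_coord_mul_sub_mul_coord_mul_sub_test σ hφ hφ i i
    simp only [if_true, ← sq] at h3
    rw [h3]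
    have hA : 0 ≤ ∫ x, φ x ^ 2 ∂γ := integral_nonneg fun x => sq_nonneg _
    have hB : 0 ≤ ∫ x, gradient φ x i ^ 2 ∂γ := integral_nonneg fun x => sq_nonneg _
    refine Real.sqrt_le_iff.2 ⟨by positivity, ?_⟩
    have hA' := Real.sq_sqrt hA
    have hB' := Real.sq_sqrt hB
    -- The cross term dropped in `√(a² + b²) ≤ a + b`.
    have hc : 0 ≤ |σ| * √(∫ x, φ x ^ 2 ∂γ) * (σ ^ 2 * √(∫ x, gradient φ x i ^ 2 ∂γ)) := by
      positivity
    calc _ = |σ| ^ 2 * √(∫ x, φ x ^ 2 ∂γ) ^ 2 +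
          σ ^ 4 * √(∫ x, gradient φ x i ^ 2 ∂γ) ^ 2 := by rw [hA', hB', sq_abs]
      _ ≤ _ := by linarith
  have h3 : (fun x => x i * φ x) = (fun x => x i * φ x - σ ^ 2 * gradient φ x i) +
      fun x => σ ^ 2 * gradient φ x i := by
    ext x; simp
  rw [h3]
  calc _ ≤ _ := eLpNorm_add_le ((hφ.coord_mul_sub i).memLp (μ := γ) 2).1
        (((hφ.gradient_apply i).const_mul _).memLp (μ := γ) 2).1 one_le_two
    _ ≤ (ENNReal.ofReal |σ| * eLpNorm φ 2 γ + ENNReal.ofReal (σ ^ 2) * eLpNorm (gradient φ) 2 γ) +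
        ENNReal.ofReal (σ ^ 2) * eLpNorm (gradient φ) 2 γ := by
      rw [h1]
      exact add_le_add (h2.trans (by gcongr)) (by gcongr)
    _ ≤ _ := by
      rw [mul_add, add_mul, add_mul, add_assoc]
      refine add_le_add ?_ ?_
      · rw [add_assoc]; exact le_self_add
      · rw [add_mul, add_mul, add_assoc]; exact le_add_self

/-- A function in the Gaussian Sobolev space is approximated by test functions `φ k` in such a
way that the products `x i * φ k` converge in `L²` as well. -/
lemma HasSobolevGradient.exists_tendstoL2 {g : EuclideanSpace ℝ (Fin n) → ℝ}
    {G : EuclideanSpace ℝ (Fin n) → EuclideanSpace ℝ (Fin n)}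
    (h : HasSobolevGradient (isotropicGaussian n σ) g G) :
    ∃ φ : ℕ → EuclideanSpace ℝ (Fin n) → ℝ, (∀ k, IsTestFunction (φ k)) ∧
      TendstoL2 (isotropicGaussian n σ) φ g ∧
      (∀ i, TendstoL2 (isotropicGaussian n σ) (fun k x => gradient (φ k) x i)
        (fun x => G x i)) ∧
      ∀ i, TendstoL2 (isotropicGaussian n σ) (fun k x => x i * φ k x) (fun x => x i * g x) := by
  set γ := isotropicGaussian n σ
  obtain ⟨φ, hφ, hlim⟩ := h.exists_approx
  obtain ⟨C, hC, hle⟩ := exists_eLpNorm_coord_mul_test_le n σ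
  set ε : ℕ → ℝ≥0∞ := fun k => eLpNorm (fun x => φ k x - g x) 2 γ +
      eLpNorm (fun x => gradient (φ k) x - G x) 2 γ
  have hlim1 : Tendsto (fun k => eLpNorm (fun x => φ k x - g x) 2 γ) atTop (𝓝 0) :=
    tendsto_of_tendsto_of_tendsto_of_le_of_le tendsto_const_nhds hlim (fun k => zero_le)
      fun k => le_self_add
  have hlim2 : Tendsto (fun k => eLpNorm (fun x => gradient (φ k) x - G x) 2 γ) atTop (𝓝 0) :=
    tendsto_of_tendsto_of_tendsto_of_le_of_le tendsto_const_nhds hlim (fun k => zero_le)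
      fun k => le_add_self
  refine ⟨φ, hφ, ⟨fun k => (hφ k).memLp 2, h.memLp, hlim1⟩, fun i =>
    ⟨fun k => ((hφ k).gradient_apply i).memLp 2, h.memLp_gradient.euclideanSpace_apply i, ?_⟩,
    fun i => ?_⟩
  · exact tendsto_of_tendsto_of_tendsto_of_le_of_le tendsto_const_nhds hlim2 (fun k => zero_le)
      fun k => eLpNorm_euclideanSpace_apply_le (μ := γ) (fun x => gradient (φ k) x - G x) 2 i
  -- The a.e. convergent subsequence identifies the limit of `x_i φ_k` as `x_i g`, whose square
  -- integrability is not yet known.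
  obtain ⟨ns, hns, hae⟩ := (tendstoInMeasure_of_tendsto_eLpNorm two_ne_zero
    (fun k => ((hφ k).memLp (μ := γ) 2).1) h.memLp.1 hlim1).exists_seq_tendsto_ae
  have hdiff : ∀ k m, eLpNorm (fun x => x i * (φ k x - φ m x)) 2 γ ≤ C * (ε k + ε m) := by
    intro k m
    refine (hle _ ((hφ k).sub (hφ m)) i).trans ?_
    refine mul_le_mul' le_rfl ?_
    have e1 : eLpNorm (fun x => φ k x - φ m x) 2 γ ≤
        eLpNorm (fun x => φ k x - g x) 2 γ + eLpNorm (fun x => φ m x - g x) 2 γ := by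
      refine le_trans (le_of_eq ?_) (eLpNorm_sub_le (((hφ k).memLp 2).sub h.memLp).1
        (((hφ m).memLp 2).sub h.memLp).1 one_le_two)
      congr 1; ext x; simp
    have e2 : eLpNorm (gradient fun x => φ k x - φ m x) 2 γ ≤
        eLpNorm (fun x => gradient (φ k) x - G x) 2 γ +
          eLpNorm (fun x => gradient (φ m) x - G x) 2 γ := by
      refine le_trans (le_of_eq ?_) (eLpNorm_sub_le
        (((hφ k).memLp_gradient 2).sub h.memLp_gradient).1
        (((hφ m).memLp_gradient 2).sub h.memLp_gradient).1 one_le_two)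
      congr 1; ext1 x
      simp [gradient_fun_sub ((hφ k).differentiable x) ((hφ m).differentiable x)]
    calc _ ≤ _ := add_le_add e1 e2
      _ = _ := by simp only [ε]; ring
  -- Fatou along the subsequence in the Cauchy estimate `hdiff`. The positive slack `1 / (k + 1)`
  -- absorbs `ε (ns m)` for large `m`.
  have hbound : ∀ k, eLpNorm (fun x => x i * φ k x - x i * g x) 2 γ ≤
      C * (ε k + ENNReal.ofReal (1 / ((k : ℝ) + 1))) := by
    intro k
    refine Lp.eLpNorm_le_of_ae_tendsto (u := atTop)
      (f := fun m x => x i * (φ k x - φ (ns m) x)) ?_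
      (fun m => ((((hφ k).sub (hφ (ns m))).coord_mul i).memLp (μ := γ) 2).1) ?_
    · have hpos : (0 : ℝ≥0∞) < ENNReal.ofReal (1 / ((k : ℝ) + 1)) :=
        ENNReal.ofReal_pos.2 (by positivity)
      filter_upwards [hns.tendsto_atTop.eventually (hlim.eventually_lt_const hpos)] with m hm
      refine (hdiff k (ns m)).trans ?_
      gcongr
    · filter_upwards [hae] with x hx
      have := (hx.const_sub (φ k x)).const_mul (x i)
      rwa [mul_sub] at this
  have hto : Tendsto (fun k : ℕ => C * (ε k + ENNReal.ofReal (1 / ((k : ℝ) + 1)))) atTop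
      (𝓝 0) := by
    have h1 : Tendsto (fun k : ℕ => ENNReal.ofReal (1 / ((k : ℝ) + 1))) atTop (𝓝 0) := by
      simpa using ENNReal.tendsto_ofReal tendsto_one_div_add_atTop_nhds_zero_nat
    simpa using ENNReal.Tendsto.const_mul (hlim.add h1) (Or.inr hC)
  have hto' : Tendsto (fun k => eLpNorm (fun x => x i * φ k x - x i * g x) 2 γ) atTop (𝓝 0) :=
    tendsto_of_tendsto_of_tendsto_of_le_of_le tendsto_const_nhds hto (fun k => zero_le) hbound
  have hmeas : AEStronglyMeasurable (fun x : EuclideanSpace ℝ (Fin n) => x i * g x) γ :=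
    (EuclideanSpace.proj (𝕜 := ℝ) i).continuous.aestronglyMeasurable.mul h.memLp.1
  refine ⟨fun k => ((hφ k).coord_mul i).memLp 2, ?_, hto'⟩
  -- One `k` at finite distance is enough: `x_i g` differs from `x_i φ_k` by a square integrable
  -- function.
  obtain ⟨k, hk⟩ := (hto'.eventually_lt_const (ENNReal.zero_lt_top)).exists
  have hm1 : MemLp (fun x => x i * φ k x) 2 γ := ((hφ k).coord_mul i).memLp 2
  have hm2 : MemLp (fun x => x i * φ k x - x i * g x) 2 γ := ⟨hm1.1.sub hmeas, hk⟩
  have := hm1.sub hm2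
  refine this.congr_norm hmeas (ae_of_all _ fun x => by simp)

end Sobolev

/-! ### Extension of the integration by parts identities to the Sobolev space. -/

section SobolevIdentities

variable {n : ℕ} {σ : ℝ}

namespace HasSobolevGradient

variable {f g : EuclideanSpace ℝ (Fin n) → ℝ}
  {F G : EuclideanSpace ℝ (Fin n) → EuclideanSpace ℝ (Fin n)}

lemma memLp_coord_mul (h : HasSobolevGradient (isotropicGaussian n σ) g G) (i : Fin n) :
    MemLp (fun x => x i * g x) 2 (isotropicGaussian n σ) := by
  obtain ⟨φ, -, -, -, h3⟩ := h.exists_tendstoL2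
  exact (h3 i).memLp_lim

lemma memLp_coord_mul_sub (h : HasSobolevGradient (isotropicGaussian n σ) g G) (i : Fin n) :
    MemLp (fun x => x i * g x - σ ^ 2 * G x i) 2 (isotropicGaussian n σ) :=
  (h.memLp_coord_mul i).sub ((h.memLp_gradient.euclideanSpace_apply i).const_mul _)

lemma integral_coord_mul (h : HasSobolevGradient (isotropicGaussian n σ) g G) (i : Fin n) :
    ∫ x, x i * g x ∂(isotropicGaussian n σ) = σ ^ 2 * ∫ x, G x i ∂(isotropicGaussian n σ) := by
  obtain ⟨φ, hφ, h1, h2, h3⟩ := h.exists_tendstoL2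
  refine tendsto_nhds_unique (h3 i).tendsto_integral ?_
  simp only [fun k => integral_coord_mul_test σ (hφ k) i]
  exact (h2 i).tendsto_integral.const_mul _

lemma integral_coord_mul_sub_mul (hf : HasSobolevGradient (isotropicGaussian n σ) f F)
    (hg : HasSobolevGradient (isotropicGaussian n σ) g G) (i : Fin n) :
    ∫ x, (x i * f x - σ ^ 2 * F x i) * g x ∂(isotropicGaussian n σ) =
      σ ^ 2 * ∫ x, f x * G x i ∂(isotropicGaussian n σ) := by
  obtain ⟨φ, hφ, h1, h2, h3⟩ := hf.exists_tendstoL2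
  obtain ⟨ψ, hψ, k1, k2, k3⟩ := hg.exists_tendstoL2
  refine tendsto_nhds_unique (((h3 i).sub ((h2 i).const_mul _)).tendsto_integral_mul k1) ?_
  simp only [fun k => integral_coord_mul_sub_mul_test σ (hφ k) (hψ k) i]
  exact (h1.tendsto_integral_mul (k2 i)).const_mul _

lemma integral_coord_mul_sub_mul_coord_mul_sub
    (hf : HasSobolevGradient (isotropicGaussian n σ) f F)
    (hg : HasSobolevGradient (isotropicGaussian n σ) g G) (i j : Fin n) :
    ∫ x, (x i * f x - σ ^ 2 * F x i) * (x j * g x - σ ^ 2 * G x j) ∂(isotropicGaussian n σ) =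
      (if i = j then σ ^ 2 * ∫ x, f x * g x ∂(isotropicGaussian n σ) else 0) +
        σ ^ 4 * ∫ x, F x j * G x i ∂(isotropicGaussian n σ) := by
  obtain ⟨φ, hφ, h1, h2, h3⟩ := hf.exists_tendstoL2
  obtain ⟨ψ, hψ, k1, k2, k3⟩ := hg.exists_tendstoL2
  refine tendsto_nhds_unique (((h3 i).sub ((h2 i).const_mul _)).tendsto_integral_mul
    ((k3 j).sub ((k2 j).const_mul _))) ?_
  simp only [fun k => integral_coord_mul_sub_mul_coord_mul_sub_test σ (hφ k) (hψ k) i j]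
  refine Tendsto.add ?_ (((h2 j).tendsto_integral_mul (k2 i)).const_mul _)
  split_ifs
  · exact (h1.tendsto_integral_mul k1).const_mul _
  · exact tendsto_const_nhds

lemma integral_coord_mul_mul_coord_mul_sub
    (hf : HasSobolevGradient (isotropicGaussian n σ) f F)
    (hg : HasSobolevGradient (isotropicGaussian n σ) g G) (i j : Fin n) :
    ∫ x, (x i * f x) * (x j * g x - σ ^ 2 * G x j) ∂(isotropicGaussian n σ) =
      (if i = j then σ ^ 2 * ∫ x, f x * g x ∂(isotropicGaussian n σ) else 0) +
        σ ^ 2 * ∫ x, (x i * g x) * F x j ∂(isotropicGaussian n σ) := by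
  obtain ⟨φ, hφ, h1, h2, h3⟩ := hf.exists_tendstoL2
  obtain ⟨ψ, hψ, k1, k2, k3⟩ := hg.exists_tendstoL2
  refine tendsto_nhds_unique ((h3 i).tendsto_integral_mul
    ((k3 j).sub ((k2 j).const_mul _))) ?_
  simp only [fun k => integral_coord_mul_mul_coord_mul_sub_test σ (hφ k) (hψ k) i j]
  refine Tendsto.add ?_ (((k3 i).tendsto_integral_mul (h2 j)).const_mul _)
  split_ifs
  · exact (h1.tendsto_integral_mul k1).const_mul _
  · exact tendsto_const_nhds

lemma integral_norm_sq_eq_sum {μ : Measure (EuclideanSpace ℝ (Fin n))} (hG : MemLp G 2 μ) :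
    ∫ x, ‖G x‖ ^ 2 ∂μ = ∑ i, ∫ x, G x i * G x i ∂μ := by
  have h := integral_finsetSum Finset.univ (f := fun i x => G x i * G x i) fun i _ =>
    (hG.euclideanSpace_apply i).integrable_mul (hG.euclideanSpace_apply i)
  rw [← h]
  simp only [EuclideanSpace.real_norm_sq_eq, ← sq]

/-- The **Gaussian Poincaré inequality** in the Gaussian Sobolev space. -/
lemma variance_le (h : HasSobolevGradient (isotropicGaussian n σ) g G) :
    ∫ x, g x * g x ∂(isotropicGaussian n σ) - (∫ x, g x ∂(isotropicGaussian n σ)) ^ 2 ≤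
      σ ^ 2 * ∫ x, ‖G x‖ ^ 2 ∂(isotropicGaussian n σ) := by
  obtain ⟨φ, hφ, h1, h2, h3⟩ := h.exists_tendstoL2
  rw [integral_norm_sq_eq_sum h.memLp_gradient]
  refine le_of_tendsto_of_tendsto'
    ((h1.tendsto_integral_mul h1).sub (h1.tendsto_integral.pow 2))
    ((tendsto_finsetSum _ fun i _ => (h2 i).tendsto_integral_mul (h2 i)).const_mul _) fun k => ?_
  obtain ⟨C, hC, hC'⟩ := (hφ k).exists_bound
  have := variance_le_integral_norm_fderiv_sq (σ := σ) ((hφ k).1.of_le (by simp)) hC hC'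
  rw [integral_norm_sq_eq_sum ((hφ k).memLp_gradient 2)] at this
  simpa only [sq (φ k _)] using this

/-- The product of a function in the Sobolev space with a test function is in the Sobolev
space. -/
lemma test_mul (h : HasSobolevGradient (isotropicGaussian n σ) g G)
    {η : EuclideanSpace ℝ (Fin n) → ℝ} (hη : IsTestFunction η) :
    HasSobolevGradient (isotropicGaussian n σ) (fun x => η x * g x)
      (fun x => η x • G x + g x • gradient η x) := by
  set γ := isotropicGaussian n σ
  obtain ⟨C, hC, hC'⟩ := hη.exists_bound
  have hC'' : ∀ x, ‖gradient η x‖ ≤ C := fun x => by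
    rw [IsTestFunction.norm_gradient_eq]; exact hC' x
  obtain ⟨φ, hφ, hlim⟩ := h.exists_approx
  have hηm : AEStronglyMeasurable η γ := hη.continuous.aestronglyMeasurable
  have hη'm : AEStronglyMeasurable (gradient η) γ := hη.continuous_gradient.aestronglyMeasurable
  have b1 : ∀ {u : EuclideanSpace ℝ (Fin n) → ℝ},
      eLpNorm (fun x => η x * u x) 2 γ ≤ ENNReal.ofReal C * eLpNorm u 2 γ := fun {u} =>
    eLpNorm_le_mul_eLpNorm_of_ae_le_mul (ae_of_all _ fun x => by
      rw [norm_mul]; exact mul_le_mul_of_nonneg_right (hC x) (norm_nonneg _)) 2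
  have b2 : ∀ {u : EuclideanSpace ℝ (Fin n) → EuclideanSpace ℝ (Fin n)},
      eLpNorm (fun x => η x • u x) 2 γ ≤ ENNReal.ofReal C * eLpNorm u 2 γ := fun {u} =>
    eLpNorm_le_mul_eLpNorm_of_ae_le_mul (ae_of_all _ fun x => by
      rw [norm_smul]; exact mul_le_mul_of_nonneg_right (hC x) (norm_nonneg _)) 2
  have b3 : ∀ {u : EuclideanSpace ℝ (Fin n) → ℝ},
      eLpNorm (fun x => u x • gradient η x) 2 γ ≤ ENNReal.ofReal C * eLpNorm u 2 γ := fun {u} =>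
    eLpNorm_le_mul_eLpNorm_of_ae_le_mul (ae_of_all _ fun x => by
      rw [norm_smul, mul_comm]; exact mul_le_mul_of_nonneg_right (hC'' x) (norm_nonneg _)) 2
  have m1 : MemLp (fun x => η x * g x) 2 γ :=
    ⟨hηm.mul h.memLp.1, b1.trans_lt (ENNReal.mul_lt_top ENNReal.ofReal_lt_top h.memLp.2)⟩
  have m2 : MemLp (fun x => η x • G x) 2 γ :=
    ⟨hηm.smul h.memLp_gradient.1,
      b2.trans_lt (ENNReal.mul_lt_top ENNReal.ofReal_lt_top h.memLp_gradient.2)⟩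
  have m3 : MemLp (fun x => g x • gradient η x) 2 γ :=
    ⟨h.memLp.1.smul hη'm, b3.trans_lt (ENNReal.mul_lt_top ENNReal.ofReal_lt_top h.memLp.2)⟩
  refine ⟨m1, m2.add m3, fun k x => η x * φ k x, fun k => hη.mul (hφ k), ?_⟩
  -- The error `φ k - g` is counted twice, in the product and in its gradient through `gradient η`;
  -- hence the factor `2C`.
  have hto : Tendsto (fun k => (ENNReal.ofReal C + ENNReal.ofReal C) *
      (eLpNorm (fun x => φ k x - g x) 2 γ + eLpNorm (fun x => gradient (φ k) x - G x) 2 γ))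
      atTop (𝓝 0) := by
    simpa using ENNReal.Tendsto.const_mul hlim
      (Or.inr (by simp : ENNReal.ofReal C + ENNReal.ofReal C ≠ ∞))
  refine tendsto_of_tendsto_of_tendsto_of_le_of_le tendsto_const_nhds hto (fun k => zero_le)
    fun k => ?_
  have e1 : eLpNorm (fun x => η x * φ k x - η x * g x) 2 γ ≤
      ENNReal.ofReal C * eLpNorm (fun x => φ k x - g x) 2 γ := by
    simp only [← mul_sub]; exact b1
  have e2 : eLpNorm (fun x => gradient (fun x => η x * φ k x) x -
      (η x • G x + g x • gradient η x)) 2 γ ≤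
      ENNReal.ofReal C * eLpNorm (fun x => gradient (φ k) x - G x) 2 γ +
        ENNReal.ofReal C * eLpNorm (fun x => φ k x - g x) 2 γ := by
    have e3 : (fun x => gradient (fun x => η x * φ k x) x - (η x • G x + g x • gradient η x)) =
        (fun x => η x • (gradient (φ k) x - G x)) + fun x => (φ k x - g x) • gradient η x := by
      ext1 x
      rw [gradient_fun_mul (hη.differentiable x) ((hφ k).differentiable x)]
      simp only [Pi.add_apply]
      module
    rw [e3]
    refine (eLpNorm_add_le (hηm.smul (((hφ k).memLp_gradient 2).sub h.memLp_gradient).1)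
      (AEStronglyMeasurable.smul (((hφ k).memLp 2).sub h.memLp).1 hη'm) one_le_two).trans
      (add_le_add b2 b3)
  calc _ ≤ _ := add_le_add e1 e2
    _ ≤ ENNReal.ofReal C * eLpNorm (fun x => φ k x - g x) 2 γ +
        (ENNReal.ofReal C * eLpNorm (fun x => gradient (φ k) x - G x) 2 γ +
        ENNReal.ofReal C * eLpNorm (fun x => φ k x - g x) 2 γ) +
        ENNReal.ofReal C * eLpNorm (fun x => gradient (φ k) x - G x) 2 γ := le_self_add
    _ = _ := by ring

lemma add (hf : HasSobolevGradient (isotropicGaussian n σ) f F)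
    (hg : HasSobolevGradient (isotropicGaussian n σ) g G) :
    HasSobolevGradient (isotropicGaussian n σ) (fun x => f x + g x) (fun x => F x + G x) := by
  obtain ⟨φ, hφ, h1⟩ := hf.exists_approx
  obtain ⟨ψ, hψ, h2⟩ := hg.exists_approx
  refine ⟨hf.memLp.add hg.memLp, hf.memLp_gradient.add hg.memLp_gradient,
    fun k x => φ k x + ψ k x, fun k => (hφ k).add (hψ k), ?_⟩
  refine tendsto_of_tendsto_of_tendsto_of_le_of_le tendsto_const_nhds
    (by simpa using h1.add h2) (fun k => zero_le) fun k => ?_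
  have e1 := eLpNorm_add_le (((hφ k).memLp 2).sub hf.memLp).1 (((hψ k).memLp 2).sub hg.memLp).1
    one_le_two
  have e2 := eLpNorm_add_le (((hφ k).memLp_gradient 2).sub hf.memLp_gradient).1
    (((hψ k).memLp_gradient 2).sub hg.memLp_gradient).1 one_le_two
  calc _ = _ := by
        congr 1
        · congr 1; ext x; exact add_sub_add_comm _ _ _ _
        · congr 1; ext1 x
          rw [gradient_fun_add ((hφ k).differentiable x) ((hψ k).differentiable x)]
          exact add_sub_add_comm _ _ _ _
    _ ≤ _ := add_le_add e1 e2
    _ = _ := add_add_add_comm _ _ _ _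

lemma zero : HasSobolevGradient (isotropicGaussian n σ) (fun _ => 0) (fun _ => 0) :=
  ⟨MemLp.zero, MemLp.zero, fun _ _ => 0, fun _ => IsTestFunction.zero, by
    simp [gradient]⟩

lemma sum {ι : Type*} {s : Finset ι} {f : ι → EuclideanSpace ℝ (Fin n) → ℝ}
    {F : ι → EuclideanSpace ℝ (Fin n) → EuclideanSpace ℝ (Fin n)}
    (h : ∀ i ∈ s, HasSobolevGradient (isotropicGaussian n σ) (f i) (F i)) :
    HasSobolevGradient (isotropicGaussian n σ) (fun x => ∑ i ∈ s, f i x)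
      (fun x => ∑ i ∈ s, F i x) := by
  classical
  induction s using Finset.induction_on with
  | empty => simpa using zero
  | insert a s ha ih =>
    simp only [Finset.sum_insert ha]
    exact (h a (Finset.mem_insert_self _ _)).add
      (ih fun i hi => h i (Finset.mem_insert_of_mem hi))

end HasSobolevGradient

end SobolevIdentities

/-! ### Cutoff functions and the Poincaré inequality for locally Sobolev functions. -/

section Cutoff

variable {n : ℕ} {σ : ℝ}

variable (n) in
-- The dilates `b (x / (m + 1))` of a single bump equal `1` on growing balls, and their gradients
-- carry a factor `1 / (m + 1)`.
lemma exists_cutoff : ∃ χ : ℕ → EuclideanSpace ℝ (Fin n) → ℝ, ∃ C : ℝ,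
    (∀ m, IsTestFunction (χ m)) ∧ (∀ m x, |χ m x| ≤ 1) ∧ (∀ m x, ‖gradient (χ m) x‖ ≤ C) ∧
      (∀ x, Tendsto (fun m => χ m x) atTop (𝓝 1)) ∧
      ∀ x, Tendsto (fun m => gradient (χ m) x) atTop (𝓝 0) := by
  let b : ContDiffBump (0 : EuclideanSpace ℝ (Fin n)) := ⟨1, 2, one_pos, one_lt_two⟩
  have hb : IsTestFunction b := ⟨b.contDiff, b.hasCompactSupport⟩
  obtain ⟨C, -, hC⟩ := hb.exists_bound
  have hC0 : 0 ≤ C := (norm_nonneg _).trans (hC 0)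
  set c : ℕ → ℝ := fun m => 1 / ((m : ℝ) + 1)
  have hc0 : ∀ m, 0 < c m := fun m => by positivity
  have hc1 : ∀ m, c m ≤ 1 := fun m => by
    rw [div_le_one (by positivity)]; linarith [(Nat.cast_nonneg m : (0 : ℝ) ≤ m)]
  have hc : Tendsto c atTop (𝓝 0) := tendsto_one_div_add_atTop_nhds_zero_nat
  have hgrad : ∀ m x, ‖gradient (fun x => b (c m • x)) x‖ ≤ c m * C := fun m x => by
    rw [IsTestFunction.norm_gradient_eq, fderiv_comp_smul, norm_smul,
      Real.norm_of_nonneg (hc0 m).le]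
    exact mul_le_mul_of_nonneg_left (hC _) (hc0 m).le
  refine ⟨fun m x => b (c m • x), C, fun m => ⟨b.contDiff.comp (contDiff_const_smul (c m)),
    b.hasCompactSupport.comp_smul (hc0 m).ne'⟩, fun m x => ?_, fun m x => ?_, fun x => ?_,
    fun x => ?_⟩
  · rw [abs_of_nonneg b.nonneg]
    exact b.le_one
  · exact (hgrad m x).trans (mul_le_of_le_one_left hC0 (hc1 m))
  · have h1 : Tendsto (fun m => c m • x) atTop (𝓝 0) := by simpa using hc.smul_const x
    exact tendsto_const_nhds.congr' (h1.eventually b.eventuallyEq_one |>.mono fun m hm => hm.symm)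
  · exact squeeze_zero_norm (fun m => hgrad m x) (by simpa using hc.mul_const C)

/-- The Gaussian Poincaré inequality for a square integrable function `u` which is locally in the
Sobolev space and whose weak gradient `V` is square integrable. -/
lemma variance_le_of_forall_test_mul {u : EuclideanSpace ℝ (Fin n) → ℝ}
    {V : EuclideanSpace ℝ (Fin n) → EuclideanSpace ℝ (Fin n)}
    (hu : MemLp u 2 (isotropicGaussian n σ)) (hV : MemLp V 2 (isotropicGaussian n σ))
    (h : ∀ η, IsTestFunction η → HasSobolevGradient (isotropicGaussian n σ)
      (fun x => η x * u x) (fun x => η x • V x + u x • gradient η x)) :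
    ∫ x, u x * u x ∂(isotropicGaussian n σ) - (∫ x, u x ∂(isotropicGaussian n σ)) ^ 2 ≤
      σ ^ 2 * ∫ x, ‖V x‖ ^ 2 ∂(isotropicGaussian n σ) := by
  set γ := isotropicGaussian n σ
  obtain ⟨χ, C, hχ, hle, hgr, hlim, hlim'⟩ := exists_cutoff n
  have hC0 : 0 ≤ C := (norm_nonneg _).trans (hgr 0 0)
  have hm : ∀ k, AEStronglyMeasurable (fun x => χ k x * u x) γ := fun k => (h _ (hχ k)).memLp.1
  have hb : ∀ k x, ‖χ k x * u x‖ ≤ ‖u x‖ := fun k x => by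
    rw [norm_mul]; exact mul_le_of_le_one_left (norm_nonneg _) (hle k x)
  have ht : ∀ x, Tendsto (fun k => χ k x * u x) atTop (𝓝 (u x)) := fun x => by
    simpa using (hlim x).mul_const (u x)
  have t1 : Tendsto (fun k => ∫ x, (χ k x * u x) * (χ k x * u x) ∂γ) atTop
      (𝓝 (∫ x, u x * u x ∂γ)) := by
    refine tendsto_integral_of_dominated_convergence (fun x => ‖u x‖ * ‖u x‖)
      (fun k => (hm k).mul (hm k)) (hu.norm.integrable_mul hu.norm)
      (fun k => ae_of_all _ fun x => ?_) (ae_of_all _ fun x => (ht x).mul (ht x))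
    rw [norm_mul]
    exact mul_le_mul (hb k x) (hb k x) (norm_nonneg _) (norm_nonneg _)
  have t2 : Tendsto (fun k => ∫ x, χ k x * u x ∂γ) atTop (𝓝 (∫ x, u x ∂γ)) :=
    tendsto_integral_of_dominated_convergence (fun x => ‖u x‖) hm
      (hu.integrable one_le_two).norm (fun k => ae_of_all _ (hb k)) (ae_of_all _ ht)
  have t3 : Tendsto (fun k => ∫ x, ‖χ k x • V x + u x • gradient (χ k) x‖ ^ 2 ∂γ) atTop
      (𝓝 (∫ x, ‖V x‖ ^ 2 ∂γ)) := by
    -- The uniform gradient bound on the cutoffs makes this one dominating function serve for all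
    -- `k`.
    have hW : MemLp (fun x => ‖V x‖ + C * ‖u x‖) 2 γ := hV.norm.add (hu.norm.const_mul C)
    refine tendsto_integral_of_dominated_convergence (fun x => (‖V x‖ + C * ‖u x‖) ^ 2)
      (fun k => (h _ (hχ k)).memLp_gradient.1.norm.pow 2) hW.integrable_sq
      (fun k => ae_of_all _ fun x => ?_) (ae_of_all _ fun x => ?_)
    · rw [norm_pow, norm_norm]
      refine pow_le_pow_left₀ (norm_nonneg _) ((norm_add_le _ _).trans (add_le_add ?_ ?_)) 2
      · rw [norm_smul]; exact mul_le_of_le_one_left (norm_nonneg _) (hle k x)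
      · rw [norm_smul, mul_comm]; exact mul_le_mul_of_nonneg_right (hgr k x) (norm_nonneg _)
    · have := ((hlim x).smul_const (V x)).add ((hlim' x).const_smul (u x))
      simpa using (this.norm.pow 2)
  exact le_of_tendsto_of_tendsto' (t1.sub (t2.pow 2)) (t3.const_mul _)
    fun k => (h _ (hχ k)).variance_le

end Cutoff

/-! ### Vector fields -/

section VectorField

namespace HasSobolevJacobian

variable {n : ℕ} {σ : ℝ} {f : EuclideanSpace ℝ (Fin n) → EuclideanSpace ℝ (Fin n)}
  {Df : EuclideanSpace ℝ (Fin n) → Matrix (Fin n) (Fin n) ℝ}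

lemma memLp_apply {μ : Measure (EuclideanSpace ℝ (Fin n))} (hf : HasSobolevJacobian μ f Df)
    (i : Fin n) : MemLp (fun x => f x i) 2 μ := (hf i).memLp

lemma memLp_jacobian {μ : Measure (EuclideanSpace ℝ (Fin n))} (hf : HasSobolevJacobian μ f Df)
    (j i : Fin n) : MemLp (fun x => Df x j i) 2 μ :=
  (hf i).memLp_gradient.euclideanSpace_apply j

lemma memLp {μ : Measure (EuclideanSpace ℝ (Fin n))} (hf : HasSobolevJacobian μ f Df) :
    MemLp f 2 μ := MemLp.of_eval_piLp hf.memLp_apply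

lemma memLp_trace {μ : Measure (EuclideanSpace ℝ (Fin n))} (hf : HasSobolevJacobian μ f Df) :
    MemLp (fun x => (Df x).trace) 2 μ :=
  memLp_finsetSum _ fun i _ => hf.memLp_jacobian i i

lemma trace_sq_eq (A : Matrix (Fin n) (Fin n) ℝ) : (A ^ 2).trace = ∑ i, ∑ j, A j i * A i j := by
  rw [Finset.sum_comm]
  simp [sq, Matrix.trace, Matrix.mul_apply]

lemma integrable_trace_sq {μ : Measure (EuclideanSpace ℝ (Fin n))}
    (hf : HasSobolevJacobian μ f Df) : Integrable (fun x => ((Df x) ^ 2).trace) μ := by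
  simp only [trace_sq_eq]
  exact integrable_finsetSum _ fun i _ => integrable_finsetSum _ fun j _ =>
    (hf.memLp_jacobian j i).integrable_mul (hf.memLp_jacobian i j)

lemma integral_trace_sq {μ : Measure (EuclideanSpace ℝ (Fin n))}
    (hf : HasSobolevJacobian μ f Df) :
    ∫ x, ((Df x) ^ 2).trace ∂μ = ∑ i, ∑ j, ∫ x, Df x j i * Df x i j ∂μ := by
  have h : ∀ i j, Integrable (fun x => Df x j i * Df x i j) μ := fun i j =>
    (hf.memLp_jacobian j i).integrable_mul (hf.memLp_jacobian i j)
  simp only [trace_sq_eq]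
  rw [integral_finsetSum _ fun i _ => integrable_finsetSum _ fun j _ => h i j]
  exact Finset.sum_congr rfl fun i _ => integral_finsetSum _ fun j _ => h i j

lemma inner_eq_sum (x y : EuclideanSpace ℝ (Fin n)) : inner ℝ x y = ∑ i, x i * y i := by
  simp [PiLp.inner_apply, mul_comm]

lemma inner_matMulVec_eq_sum (A : Matrix (Fin n) (Fin n) ℝ) (v x : EuclideanSpace ℝ (Fin n)) :
    inner ℝ v (matMulVec A x) = ∑ i, ∑ j, (x i * v j) * A j i := by
  rw [Finset.sum_comm, inner_eq_sum]
  refine Finset.sum_congr rfl fun j _ => ?_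
  simp only [matMulVec, Matrix.mulVec, dotProduct, Finset.mul_sum]
  exact Finset.sum_congr rfl fun i _ => by ring

lemma inner_sub_trace_eq_sum (x : EuclideanSpace ℝ (Fin n)) :
    inner ℝ x (f x) - σ ^ 2 * (Df x).trace = ∑ i, (x i * f x i - σ ^ 2 * Df x i i) := by
  rw [inner_eq_sum, Finset.sum_sub_distrib, ← Finset.mul_sum]
  rfl

variable (hf : HasSobolevJacobian (isotropicGaussian n σ) f Df)
include hf

lemma memLp_inner : MemLp (fun x => inner ℝ x (f x)) 2 (isotropicGaussian n σ) := by
  simp only [inner_eq_sum]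
  exact memLp_finsetSum _ fun i _ => (hf i).memLp_coord_mul i

lemma memLp_inner_sub_trace : MemLp (fun x => inner ℝ x (f x) - σ ^ 2 * (Df x).trace) 2
    (isotropicGaussian n σ) :=
  hf.memLp_inner.sub (hf.memLp_trace.const_mul _)

lemma integrable_inner_matMulVec :
    Integrable (fun x => inner ℝ (f x) (matMulVec (Df x) x)) (isotropicGaussian n σ) := by
  simp only [inner_matMulVec_eq_sum]
  exact integrable_finsetSum _ fun i _ => integrable_finsetSum _ fun j _ =>
    ((hf j).memLp_coord_mul i).integrable_mul (hf.memLp_jacobian j i)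

lemma integral_inner_matMulVec :
    ∫ x, inner ℝ (f x) (matMulVec (Df x) x) ∂(isotropicGaussian n σ) =
      ∑ i, ∑ j, ∫ x, (x i * f x j) * Df x j i ∂(isotropicGaussian n σ) := by
  have h : ∀ i j, Integrable (fun x => (x i * f x j) * Df x j i) (isotropicGaussian n σ) :=
    fun i j => ((hf j).memLp_coord_mul i).integrable_mul (hf.memLp_jacobian j i)
  simp only [inner_matMulVec_eq_sum]
  rw [integral_finsetSum _ fun i _ => integrable_finsetSum _ fun j _ => h i j]
  exact Finset.sum_congr rfl fun i _ => integral_finsetSum _ fun j _ => h i j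

lemma integral_inner_sub_trace :
    ∫ x, (inner ℝ x (f x) - σ ^ 2 * (Df x).trace) ∂(isotropicGaussian n σ) = 0 := by
  have h : ∀ i, Integrable (fun x => x i * f x i - σ ^ 2 * Df x i i) (isotropicGaussian n σ) :=
    fun i => ((hf i).memLp_coord_mul_sub i).integrable one_le_two
  simp only [inner_sub_trace_eq_sum]
  rw [integral_finsetSum _ fun i _ => h i]
  refine Finset.sum_eq_zero fun i _ => ?_
  have h1 := (hf i).integral_coord_mul i
  have h2 : Integrable (fun x => x i * f x i) (isotropicGaussian n σ) :=
    ((hf i).memLp_coord_mul i).integrable one_le_two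
  have h3 : Integrable (fun x => Df x i i) (isotropicGaussian n σ) :=
    (hf.memLp_jacobian i i).integrable one_le_two
  rw [integral_sub h2 (h3.const_mul _), integral_const_mul, h1]
  exact sub_self _

lemma integral_inner_sub_trace_mul {g : EuclideanSpace ℝ (Fin n) → ℝ}
    {Dg : EuclideanSpace ℝ (Fin n) → EuclideanSpace ℝ (Fin n)}
    (hg : HasSobolevGradient (isotropicGaussian n σ) g Dg) :
    ∫ x, (inner ℝ x (f x) - σ ^ 2 * (Df x).trace) * g x ∂(isotropicGaussian n σ) =
      σ ^ 2 * ∫ x, inner ℝ (f x) (Dg x) ∂(isotropicGaussian n σ) := by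
  have h1 : ∀ i, Integrable (fun x => (x i * f x i - σ ^ 2 * Df x i i) * g x)
      (isotropicGaussian n σ) := fun i => ((hf i).memLp_coord_mul_sub i).integrable_mul hg.memLp
  have h2 : ∀ i, Integrable (fun x => f x i * Dg x i) (isotropicGaussian n σ) := fun i =>
    (hf.memLp_apply i).integrable_mul (hg.memLp_gradient.euclideanSpace_apply i)
  simp only [inner_sub_trace_eq_sum, Finset.sum_mul]
  simp only [inner_eq_sum]
  rw [integral_finsetSum _ fun i _ => h1 i, integral_finsetSum _ fun i _ => h2 i,
    Finset.mul_sum]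
  exact Finset.sum_congr rfl fun i _ => (hf i).integral_coord_mul_sub_mul hg i

/-- Summing over `i, j`, the diagonal terms give `‖f‖²`. The crossed indices in `∂_j f_i · ∂_i f_j`
give the trace of the squared Jacobian, not its Frobenius norm. -/
lemma integral_inner_sub_trace_mul_self :
    ∫ x, (inner ℝ x (f x) - σ ^ 2 * (Df x).trace) * (inner ℝ x (f x) - σ ^ 2 * (Df x).trace)
        ∂(isotropicGaussian n σ) =
      σ ^ 2 * ∫ x, ‖f x‖ ^ 2 ∂(isotropicGaussian n σ) +
        σ ^ 4 * ∫ x, ((Df x) ^ 2).trace ∂(isotropicGaussian n σ) := by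
  have h : ∀ i j, Integrable (fun x => (x i * f x i - σ ^ 2 * Df x i i) *
      (x j * f x j - σ ^ 2 * Df x j j)) (isotropicGaussian n σ) := fun i j =>
    ((hf i).memLp_coord_mul_sub i).integrable_mul ((hf j).memLp_coord_mul_sub j)
  have h' : ∀ i j, ∫ x, (x i * f x i - σ ^ 2 * Df x i i) * (x j * f x j - σ ^ 2 * Df x j j)
      ∂(isotropicGaussian n σ) =
      (if i = j then σ ^ 2 * ∫ x, f x i * f x j ∂(isotropicGaussian n σ) else 0) +
        σ ^ 4 * ∫ x, Df x j i * Df x i j ∂(isotropicGaussian n σ) := fun i j =>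
    (hf i).integral_coord_mul_sub_mul_coord_mul_sub (hf j) i j
  simp only [inner_sub_trace_eq_sum, Finset.sum_mul_sum]
  rw [integral_finsetSum _ fun i _ => integrable_finsetSum _ fun j _ => h i j,
    HasSobolevGradient.integral_norm_sq_eq_sum hf.memLp, hf.integral_trace_sq, Finset.mul_sum,
    Finset.mul_sum, ← Finset.sum_add_distrib]
  refine Finset.sum_congr rfl fun i _ => ?_
  rw [integral_finsetSum _ fun j _ => h i j,
    Finset.sum_congr rfl fun j _ => h' i j,
    Finset.sum_add_distrib, Finset.mul_sum, Finset.sum_ite_eq]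
  simp

lemma integral_inner_mul_inner_sub_trace :
    ∫ x, inner ℝ x (f x) * (inner ℝ x (f x) - σ ^ 2 * (Df x).trace)
        ∂(isotropicGaussian n σ) =
      σ ^ 2 * ∫ x, ‖f x‖ ^ 2 ∂(isotropicGaussian n σ) +
        σ ^ 2 * ∫ x, inner ℝ (f x) (matMulVec (Df x) x) ∂(isotropicGaussian n σ) := by
  have h : ∀ i j, Integrable (fun x => (x i * f x i) *
      (x j * f x j - σ ^ 2 * Df x j j)) (isotropicGaussian n σ) := fun i j =>
    ((hf i).memLp_coord_mul i).integrable_mul ((hf j).memLp_coord_mul_sub j)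
  have h' : ∀ i j, ∫ x, (x i * f x i) * (x j * f x j - σ ^ 2 * Df x j j)
      ∂(isotropicGaussian n σ) =
      (if i = j then σ ^ 2 * ∫ x, f x i * f x j ∂(isotropicGaussian n σ) else 0) +
        σ ^ 2 * ∫ x, (x i * f x j) * Df x j i ∂(isotropicGaussian n σ) := fun i j =>
    (hf i).integral_coord_mul_mul_coord_mul_sub (hf j) i j
  simp only [inner_sub_trace_eq_sum]
  simp only [inner_eq_sum (_ : EuclideanSpace ℝ (Fin n)) (f _), Finset.sum_mul_sum]
  rw [integral_finsetSum _ fun i _ => integrable_finsetSum _ fun j _ => h i j,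
    HasSobolevGradient.integral_norm_sq_eq_sum hf.memLp, hf.integral_inner_matMulVec,
    Finset.mul_sum, Finset.mul_sum, ← Finset.sum_add_distrib]
  refine Finset.sum_congr rfl fun i _ => ?_
  rw [integral_finsetSum _ fun j _ => h i j,
    Finset.sum_congr rfl fun j _ => h' i j,
    Finset.sum_add_distrib, Finset.mul_sum, Finset.sum_ite_eq]
  simp

/-- The unbounded coordinate is absorbed into the multiplier: `η (x·f) = ∑ (x_i η) f_i`, where each
`x_i η` is again a test function. -/
lemma hasSobolevGradient_test_mul_inner {η : EuclideanSpace ℝ (Fin n) → ℝ}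
    (hη : IsTestFunction η) :
    HasSobolevGradient (isotropicGaussian n σ) (fun x => η x * inner ℝ x (f x))
      (fun x => η x • (f x + matMulVec (Df x) x) + (inner ℝ x (f x) : ℝ) • gradient η x) := by
  have h := HasSobolevGradient.sum (s := Finset.univ)
    fun i _ => (hf i).test_mul (hη.coord_mul i)
  convert h using 2 with x x
  · rw [inner_eq_sum, Finset.mul_sum]
    exact Finset.sum_congr rfl fun i _ => by ring
  · ext j
    simp only [PiLp.add_apply, PiLp.smul_apply, smul_eq_mul, WithLp.ofLp_sum, Finset.sum_apply,
      gradient_coord_mul_apply (hη.differentiable x), matMulVec, Matrix.mulVec, dotProduct,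
      Matrix.col_apply, inner_eq_sum, mul_add, Finset.sum_add_distrib, mul_ite, mul_zero,
      Finset.sum_ite_eq', Finset.mem_univ, if_true, Finset.mul_sum, Finset.sum_mul]
    have e1 : ∀ i, x i * η x * Df x j i = η x * (Df x j i * x i) := fun i => by ring
    have e2 : ∀ i, f x i * (x i * gradient η x j) = x i * f x i * gradient η x j :=
      fun i => by ring
    simp only [e1, e2]
    ring

/-- The Gaussian Poincaré inequality for `x ↦ ⟪x, f x⟫`, whose gradient is `f x + ∇f x x`. -/
lemma variance_inner_le (h : MemLp (fun x => matMulVec (Df x) x) 2 (isotropicGaussian n σ)) :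
    ∫ x, inner ℝ x (f x) * inner ℝ x (f x) ∂(isotropicGaussian n σ) -
        (∫ x, inner ℝ x (f x) ∂(isotropicGaussian n σ)) ^ 2 ≤
      σ ^ 2 * (∫ x, ‖f x‖ ^ 2 ∂(isotropicGaussian n σ) +
        2 * ∫ x, inner ℝ (f x) (matMulVec (Df x) x) ∂(isotropicGaussian n σ) +
        ∫ x, ‖matMulVec (Df x) x‖ ^ 2 ∂(isotropicGaussian n σ)) := by
  refine (variance_le_of_forall_test_mul hf.memLp_inner (hf.memLp.add h)
    fun η hη => hf.hasSobolevGradient_test_mul_inner hη).trans_eq ?_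
  have h1 : Integrable (fun x => ‖f x‖ ^ 2) (isotropicGaussian n σ) :=
    hf.memLp.integrable_norm_pow two_ne_zero
  have h2 : Integrable (fun x => ‖matMulVec (Df x) x‖ ^ 2) (isotropicGaussian n σ) :=
    h.integrable_norm_pow two_ne_zero
  have h3 : Integrable (fun x => ‖f x‖ ^ 2 + 2 * inner ℝ (f x) (matMulVec (Df x) x))
      (isotropicGaussian n σ) := h1.add (hf.integrable_inner_matMulVec.const_mul 2)
  simp only [Pi.add_apply, norm_add_sq_real]
  rw [integral_add h3 h2, integral_add h1 (hf.integrable_inner_matMulVec.const_mul 2), integral_const_mul]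

end HasSobolevJacobian

end VectorField

/-! ### Transfer of moments from the law to the random vector. -/

section Transfer

variable {Ω α : Type*} [MeasurableSpace Ω] [MeasurableSpace α] {P : Measure Ω} {μ : Measure α}
  {z : Ω → α}

lemma ProbabilityTheory.HasLaw.memLp_comp (hz : HasLaw z μ P) {u : α → ℝ} {p : ℝ≥0∞}
    (hu : MemLp u p μ) : MemLp (fun ω => u (z ω)) p P := by
  rw [← hz.map_eq] at hu
  exact hu.comp_of_map hz.aemeasurable

lemma ProbabilityTheory.HasLaw.integrable_comp (hz : HasLaw z μ P) {u : α → ℝ}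
    (hu : Integrable u μ) : Integrable (fun ω => u (z ω)) P := by
  rw [← hz.map_eq] at hu
  exact hu.comp_aemeasurable hz.aemeasurable

lemma ProbabilityTheory.HasLaw.variance_comp_eq_sub [IsProbabilityMeasure P] (hz : HasLaw z μ P)
    {u : α → ℝ} (hu : MemLp u 2 μ) :
    Var[fun ω => u (z ω); P] = ∫ x, u x * u x ∂μ - (∫ x, u x ∂μ) ^ 2 := by
  have h1 := hz.integral_comp hu.1
  have h2 := hz.integral_comp (f := fun x => u x * u x) (hu.1.mul hu.1)
  rw [variance_eq_sub (hz.memLp_comp hu), ← h1, ← h2]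
  simp [sq]

end Transfer

theorem mainTheorem2 {n : ℕ} {σ : ℝ} (hσ : 0 < σ)
    {Ω : Type*} [MeasurableSpace Ω] {P : Measure Ω} [IsProbabilityMeasure P]
    {z : Ω → EuclideanSpace ℝ (Fin n)} (hz : HasLaw z (isotropicGaussian n σ) P)
    {f : EuclideanSpace ℝ (Fin n) → EuclideanSpace ℝ (Fin n)}
    {Df : EuclideanSpace ℝ (Fin n) → Matrix (Fin n) (Fin n) ℝ}
    (hf : HasSobolevJacobian (isotropicGaussian n σ) f Df) :
    -- variance formula and upper bound for every `g` in the Sobolev space, with weak gradient `Dg`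
    (∀ (g : EuclideanSpace ℝ (Fin n) → ℝ)
        (Dg : EuclideanSpace ℝ (Fin n) → EuclideanSpace ℝ (Fin n)),
      HasSobolevGradient (isotropicGaussian n σ) g Dg →
      -- all the variances and expectations are finite
      MemLp (fun ω => inner ℝ (z ω) (f (z ω)) - σ ^ 2 * (Df (z ω)).trace - g (z ω)) 2 P ∧
      MemLp (fun ω => g (z ω)) 2 P ∧
      Integrable (fun ω => ‖Dg (z ω)‖ ^ 2) P ∧
      Integrable (fun ω => σ ^ 2 * ‖f (z ω) - Dg (z ω)‖ ^ 2
        + σ ^ 4 * ((Df (z ω)) ^ 2).trace) P ∧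
      Var[fun ω => inner ℝ (z ω) (f (z ω)) - σ ^ 2 * (Df (z ω)).trace - g (z ω); P] =
        (∫ ω, (σ ^ 2 * ‖f (z ω) - Dg (z ω)‖ ^ 2 + σ ^ 4 * ((Df (z ω)) ^ 2).trace) ∂P)
          + (Var[fun ω => g (z ω); P] - σ ^ 2 * ∫ ω, ‖Dg (z ω)‖ ^ 2 ∂P) ∧
      Var[fun ω => inner ℝ (z ω) (f (z ω)) - σ ^ 2 * (Df (z ω)).trace - g (z ω); P] ≤
        ∫ ω, (σ ^ 2 * ‖f (z ω) - Dg (z ω)‖ ^ 2 + σ ^ 4 * ((Df (z ω)) ^ 2).trace) ∂P) ∧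
    -- variance of the divergence; again all the terms of the identity are finite
    MemLp (fun ω => (Df (z ω)).trace) 2 P ∧
    MemLp (fun ω => inner ℝ (z ω) (f (z ω)) / σ ^ 2) 2 P ∧
    Integrable (fun ω => ((Df (z ω)) ^ 2).trace) P ∧
    Integrable (fun ω => ‖σ⁻¹ • f (z ω)‖ ^ 2) P ∧
    Integrable (fun ω => inner ℝ (f (z ω)) (matMulVec (Df (z ω)) (z ω)) / σ ^ 2) P ∧
    Var[fun ω => (Df (z ω)).trace; P] =
      (∫ ω, ((Df (z ω)) ^ 2).trace ∂P) + Var[fun ω => inner ℝ (z ω) (f (z ω)) / σ ^ 2; P]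
        - (∫ ω, ‖σ⁻¹ • f (z ω)‖ ^ 2 ∂P)
        - 2 * ∫ ω, inner ℝ (f (z ω)) (matMulVec (Df (z ω)) (z ω)) / σ ^ 2 ∂P ∧
    -- the last expectation is taken in `[0, ∞]`
    ((Var[fun ω => (Df (z ω)).trace; P] : ℝ) : EReal) ≤
      ((∫ ω, ((Df (z ω)) ^ 2).trace ∂P : ℝ) : EReal)
        + ((∫⁻ ω, ENNReal.ofReal (‖σ⁻¹ • matMulVec (Df (z ω)) (z ω)‖ ^ 2) ∂P : ℝ≥0∞) : EReal) := by

  set γ := isotropicGaussian n σ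
  have hn : Integrable (fun x => ‖f x‖ ^ 2) γ := hf.memLp.integrable_norm_pow two_ne_zero
  have hd0 := hf.integral_inner_sub_trace
  have hdd := hf.integral_inner_sub_trace_mul_self
  have hdL := hf.memLp_inner_sub_trace
  have hUL := hf.memLp_inner
  have hTL := hf.memLp_trace
  have hUd := hf.integral_inner_mul_inner_sub_trace
  have hti := hf.integrable_trace_sq
  have hfm := hf.integrable_inner_matMulVec
  set U : EuclideanSpace ℝ (Fin n) → ℝ := fun x => inner ℝ x (f x)
  set T : EuclideanSpace ℝ (Fin n) → ℝ := fun x => (Df x).trace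
  set d : EuclideanSpace ℝ (Fin n) → ℝ := fun x => U x - σ ^ 2 * T x
  have hσ2 : σ ^ 2 ≠ 0 := by positivity
  have hUL' : MemLp (fun x => U x / σ ^ 2) 2 γ := by
    simpa only [div_eq_mul_inv] using hUL.mul_const _
  have hn' : ∀ x, ‖σ⁻¹ • f x‖ ^ 2 = (σ ^ 2)⁻¹ * ‖f x‖ ^ 2 := fun x => by
    rw [norm_smul, mul_pow, Real.norm_eq_abs, sq_abs, inv_pow]
  have e6 : ∫ x, U x / σ ^ 2 * (U x / σ ^ 2) ∂γ = (∫ x, U x * U x ∂γ) / σ ^ 4 := by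
    rw [← integral_div]
    congr 1
    ext x
    field_simp
  -- the identity for the variance of the divergence
  have hvarT : Var[fun ω => T (z ω); P] =
      (∫ ω, ((Df (z ω)) ^ 2).trace ∂P) + Var[fun ω => U (z ω) / σ ^ 2; P]
        - (∫ ω, ‖σ⁻¹ • f (z ω)‖ ^ 2 ∂P)
        - 2 * ∫ ω, inner ℝ (f (z ω)) (matMulVec (Df (z ω)) (z ω)) / σ ^ 2 ∂P := by
    have e1 := hz.integral_comp hti.1
    have e2 := hz.integral_comp hn.1
    have e3 := hz.integral_comp hfm.1
    simp only [Function.comp_def] at e1 e2 e3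
    rw [hz.variance_comp_eq_sub hTL, hz.variance_comp_eq_sub hUL', e1]
    simp only [hn', integral_const_mul, integral_div, e2, e3]
    have e4 : ∫ x, U x ∂γ = σ ^ 2 * ∫ x, T x ∂γ := by
      have := integral_sub (hUL.integrable one_le_two)
        ((hTL.integrable one_le_two).const_mul (σ ^ 2))
      rw [hd0, integral_const_mul] at this
      linarith
    -- The square of `σ² T = U - d`; the pairings `U d` and `d d` are known, so only the second
    -- moment of `U` remains.
    have e5 : σ ^ 4 * ∫ x, T x * T x ∂γ = ∫ x, U x * U x ∂γ - 2 * ∫ x, U x * d x ∂γ +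
        ∫ x, d x * d x ∂γ := by
      have i1 : Integrable (fun x => U x * U x) γ := hUL.integrable_mul hUL
      have i2 : Integrable (fun x => U x * d x) γ := hUL.integrable_mul hdL
      have i3 : Integrable (fun x => d x * d x) γ := hdL.integrable_mul hdL
      have i4 : Integrable (fun x => U x * U x - 2 * (U x * d x)) γ := i1.sub (i2.const_mul 2)
      rw [← integral_const_mul, ← integral_const_mul, ← integral_sub i1 (i2.const_mul 2),
        ← integral_add i4 i3]
      congr 1
      ext x
      simp only [d]
      ring
    rw [e6, e4]
    have e7 : ∫ x, T x * T x ∂γ = (∫ x, U x * U x ∂γ - 2 * ∫ x, U x * d x ∂γ +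
        ∫ x, d x * d x ∂γ) / σ ^ 4 := by
      rw [← e5]; field_simp
    rw [e7, hUd, hdd]
    field_simp
    ring
  refine ⟨fun g Dg hg => ?_, hz.memLp_comp hTL, hz.memLp_comp hUL', hz.integrable_comp hti, ?_, ?_,
    hvarT, ?_⟩
  · have hG : Integrable (fun x => ‖Dg x‖ ^ 2) γ :=
      hg.memLp_gradient.integrable_norm_pow two_ne_zero
    have hfG : Integrable (fun x => ‖f x - Dg x‖ ^ 2) γ :=
      (hf.memLp.sub hg.memLp_gradient).integrable_norm_pow two_ne_zero
    have hI : Integrable (fun x => σ ^ 2 * ‖f x - Dg x‖ ^ 2 + σ ^ 4 * ((Df x) ^ 2).trace) γ :=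
      (hfG.const_mul _).add (hti.const_mul _)
    have hL : MemLp (fun x => d x - g x) 2 γ := hdL.sub hg.memLp
    have hdg := hf.integral_inner_sub_trace_mul hg
    have hfD : Integrable (fun x => inner ℝ (f x) (Dg x)) γ := by
      simp only [HasSobolevJacobian.inner_eq_sum]
      exact integrable_finsetSum _ fun i _ =>
        (hf.memLp_apply i).integrable_mul (hg.memLp_gradient.euclideanSpace_apply i)
    have e1 := hz.integral_comp hI.1
    have e2 := hz.integral_comp hG.1
    simp only [Function.comp_def] at e1 e2
    have hvar : Var[fun ω => d (z ω) - g (z ω); P] =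
        (∫ ω, (σ ^ 2 * ‖f (z ω) - Dg (z ω)‖ ^ 2 + σ ^ 4 * ((Df (z ω)) ^ 2).trace) ∂P)
          + (Var[fun ω => g (z ω); P] - σ ^ 2 * ∫ ω, ‖Dg (z ω)‖ ^ 2 ∂P) := by
      rw [hz.variance_comp_eq_sub hL, hz.variance_comp_eq_sub hg.memLp, e1, e2,
        integral_add (hfG.const_mul _) (hti.const_mul _), integral_const_mul, integral_const_mul,
        integral_sub (hdL.integrable one_le_two) (hg.memLp.integrable one_le_two), hd0]
      -- The cross term here matches that of `e4` through `E[d g] = σ² E[f·∇g]`. The leftover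
      -- `E‖∇g‖²` goes into the correction term.
      have e3 : ∫ x, ‖f x - Dg x‖ ^ 2 ∂γ = ∫ x, ‖f x‖ ^ 2 ∂γ -
          2 * ∫ x, inner ℝ (f x) (Dg x) ∂γ + ∫ x, ‖Dg x‖ ^ 2 ∂γ := by
        have i1 : Integrable (fun x => ‖f x‖ ^ 2 - 2 * inner ℝ (f x) (Dg x)) γ :=
          hn.sub (hfD.const_mul 2)
        simp only [norm_sub_sq_real]
        rw [integral_add i1 hG, integral_sub hn (hfD.const_mul 2), integral_const_mul]
      have e4 : ∫ x, (d x - g x) * (d x - g x) ∂γ = ∫ x, d x * d x ∂γ -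
          2 * ∫ x, d x * g x ∂γ + ∫ x, g x * g x ∂γ := by
        have i1 : Integrable (fun x => d x * d x) γ := hdL.integrable_mul hdL
        have i2 : Integrable (fun x => d x * g x) γ := hdL.integrable_mul hg.memLp
        have i3 : Integrable (fun x => g x * g x) γ := hg.memLp.integrable_mul hg.memLp
        have i4 : Integrable (fun x => d x * d x - 2 * (d x * g x)) γ := i1.sub (i2.const_mul 2)
        rw [← integral_const_mul, ← integral_sub i1 (i2.const_mul 2), ← integral_add i4 i3]
        congr 1
        ext x
        ring
      rw [e3, e4, hdd, hdg]
      ring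
    refine ⟨hz.memLp_comp hL, hz.memLp_comp hg.memLp, hz.integrable_comp hG,
      hz.integrable_comp hI, hvar, hvar.trans_le ?_⟩
    have hp := hg.variance_le
    rw [hz.variance_comp_eq_sub hg.memLp, e2]
    linarith
  · simp only [hn']
    exact hz.integrable_comp (hn.const_mul _)
  · exact hz.integrable_comp (hfm.div_const _)
  · have hN : AEStronglyMeasurable (fun x => matMulVec (Df x) x) γ :=
      -- At exponent `0`, `MemLp` is mere measurability, so this is measurability checked by
      -- components.
      (MemLp.of_eval_piLp (p := 0) fun j => memLp_zero_iff_aestronglyMeasurable.2 (by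
        simp only [matMulVec, Matrix.mulVec, dotProduct]
        exact Finset.aestronglyMeasurable_fun_sum _ fun i _ => (hf.memLp_jacobian j i).1.mul
          (EuclideanSpace.proj (𝕜 := ℝ) i).continuous.aestronglyMeasurable)).1
    have e1 : ∫⁻ ω, ENNReal.ofReal (‖σ⁻¹ • matMulVec (Df (z ω)) (z ω)‖ ^ 2) ∂P =
        ∫⁻ x, ENNReal.ofReal (‖σ⁻¹ • matMulVec (Df x) x‖ ^ 2) ∂γ :=
      hz.lintegral_comp ((hN.const_smul σ⁻¹).norm.pow 2).aemeasurable.ennreal_ofReal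
    rw [e1]
    by_cases htop : ∫⁻ x, ENNReal.ofReal (‖σ⁻¹ • matMulVec (Df x) x‖ ^ 2) ∂γ = ∞
    · rw [htop, EReal.coe_ennreal_top, EReal.coe_add_top]
      exact le_top
    have hi : Integrable (fun x => ‖σ⁻¹ • matMulVec (Df x) x‖ ^ 2) γ :=
      (lintegral_ofReal_ne_top_iff_integrable ((hN.const_smul σ⁻¹).norm.pow 2)
        (ae_of_all _ fun x => sq_nonneg _)).1 htop
    have hσN : MemLp (fun x => σ⁻¹ • matMulVec (Df x) x) 2 γ :=
      (memLp_two_iff_integrable_sq_norm (hN.const_smul σ⁻¹)).2 hi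
    -- Finiteness of the last expectation is exactly what makes the gradient `f + (∇f)x` square
    -- integrable.
    have hM : MemLp (fun x => matMulVec (Df x) x) 2 γ := by
      refine (hσN.const_smul σ).ae_eq (ae_of_all _ fun x => ?_)
      simp [smul_smul, hσ.ne']
    have hpo := hf.variance_inner_le hM
    rw [← ofReal_integral_eq_lintegral_ofReal hi (ae_of_all _ fun x => sq_nonneg _),
      EReal.coe_ennreal_ofReal, max_eq_left (integral_nonneg fun x => sq_nonneg _),
      ← EReal.coe_add, EReal.coe_le_coe_iff, hvarT]
    have e2 := hz.integral_comp hn.1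
    have e3 := hz.integral_comp hfm.1
    simp only [Function.comp_def] at e2 e3
    have hn'' : ∀ x, ‖σ⁻¹ • matMulVec (Df x) x‖ ^ 2 = (σ ^ 2)⁻¹ * ‖matMulVec (Df x) x‖ ^ 2 :=
      fun x => by rw [norm_smul, mul_pow, Real.norm_eq_abs, sq_abs, inv_pow]
    have e4 : Var[fun ω => U (z ω) / σ ^ 2; P] =
        (∫ x, U x * U x ∂γ - (∫ x, U x ∂γ) ^ 2) / σ ^ 4 := by
      rw [hz.variance_comp_eq_sub hUL', e6, integral_div, sub_div, div_pow, ← pow_mul]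
    -- Poincaré for `x·f` divided by `σ⁴`. The `‖f‖²` and mixed terms cancel against those of
    -- `hvarT`.
    have e5 : Var[fun ω => U (z ω) / σ ^ 2; P] ≤ (σ ^ 2)⁻¹ * (∫ x, ‖f x‖ ^ 2 ∂γ +
        2 * ∫ x, inner ℝ (f x) (matMulVec (Df x) x) ∂γ +
        ∫ x, ‖matMulVec (Df x) x‖ ^ 2 ∂γ) := by
      rw [e4, div_le_iff₀ (by positivity)]
      refine hpo.trans_eq ?_
      field_simp
      rfl
    simp only [hn', hn'', integral_const_mul, e2, e3, div_eq_inv_mul] at e5 ⊢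
    linarith
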